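/- Let $G$ be a finite abelian group (written additively) with $|G| = 2n$. A set $B \subseteq G$ is sum-free if there are no $x,y,z \in B$ (not necessarily distinct) with $x+y=z$, and $\mathrm{SF}(G)$ is the collection of maximum-size sum-free subsets of $G$ (these are exactly the odd cosets, i.e. the non-trivial cosets of the index-2 subgroups of $G$). Let $r(G)$ be the number of $x \in G$ with $x=-x$, put $\alpha(G) = \log r(G)/\log n$ and $\beta(G) = r(G)/n$, and for $\delta>0$ define $$\lambda^{(\delta)}(G) = \begin{cases} 1/3 & \text{if } \alpha(G) \le 5/6,\\ \alpha(G) - 1/2 & \text{if } \alpha(G) > 5/6 \text{ and } \beta(G) < \delta,\\ 2/(4-\beta(G)) & \text{otherwise.}\end{cases}$$ For $\mathcal{O} \in \mathrm{SF}(G)$, $\mathcal{E} = G \setminus \mathcal{O}$, $A \subseteq G$ and $k \in \mathbb{N}$, let $\mathcal{B}_k^{\mathcal{O}}(A)$ be the event that there exist $S \subseteq A \cap \mathcal{E}$ and $T \subseteq A \cap \mathcal{O}$ with $|S| = k \ge |T|$ such that $((A \cap \mathcal{O}) \cup S) \setminus T$ is sum-free. Lemma. For every $\varepsilon > 0$ there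 is $\delta_0 = \delta_0(\varepsilon) > 0$ such that for every $0 < \delta < \delta_0$ there is $n_0 = n_0(\varepsilon,\delta)$ such that the following holds for every $n \ge n_0$, every abelian group $G$ of order $2n$, every $\mathcal{O} \in \mathrm{SF}(G)$ and every real $p$ with $$p \ge (1+\varepsilon)\sqrt{\lambda^{(\delta)}(G)\,\frac{\log n}{n}} \qquad\text{and}\qquad (1+\delta)p \le 1.$$ Let $A$ be the random subset of $G$ that contains each element of $\mathcal{O}$ with probability $(1-\delta)p$ and each element of $\mathcal{E}$ with probability $(1+\delta)p$, all independently. Then $$\mathbb{P}\big(\mathcal{B}_k^{\mathcal{O}}(A)\big) \le \max\big\{ n^{-\delta k},\, e^{-\sqrt n} \big\}$$ for every integer $k$ with $1 \le k \le \delta p n$. -/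

import Mathlib

namespace SumFreeThreshold

/-- A set `B` is sum-free if `B ∩ (B + B) = ∅`, i.e. `x + y = z` has no solution in `B`
(with `x = y` allowed). -/
def SumFree {G : Type*} [AddCommGroup G] (B : Finset G) : Prop :=
  ∀ x ∈ B, ∀ y ∈ B, x + y ∉ B

/-- `SF A` is the collection of maximum-size sum-free subsets of `A`. -/
def SF {G : Type*} [AddCommGroup G] (A : Finset G) : Set (Finset G) :=
  {B | B ⊆ A ∧ SumFree B ∧ ∀ C : Finset G, C ⊆ A → SumFree C → C.card ≤ B.card}

/-- `r G` is the number of elements `x` of `G` with `x = -x` (the identity included). -/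
noncomputable def r (G : Type*) [AddCommGroup G] : ℕ :=
  Nat.card {x : G // x = -x}

/-- `α(G) = log r(G) / log n`, where `|G| = 2n`. -/
noncomputable def alpha (G : Type*) [AddCommGroup G] : ℝ :=
  Real.log (r G) / Real.log ((Nat.card G : ℝ) / 2)

/-- `β(G) = r(G) / n`, where `|G| = 2n`. -/
noncomputable def beta (G : Type*) [AddCommGroup G] : ℝ :=
  (r G : ℝ) / ((Nat.card G : ℝ) / 2)

open Classical in
/-- The constant `λ^{(δ)}(G)`. -/
noncomputable def lam (δ : ℝ) (G : Type*) [AddCommGroup G] : ℝ :=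
  if alpha G ≤ 5 / 6 then 1 / 3
  else if beta G < δ then alpha G - 1 / 2
  else 2 / (4 - beta G)

open Classical in
/-- The probability that the random subset `A` of `G` containing each `x` independently with
probability `q x` satisfies `P`. -/
noncomputable def randomSubsetProb {G : Type*} [Fintype G] (q : G → ℝ)
    (P : Finset G → Prop) : ℝ :=
  ∑ A : Finset G, if P A then (∏ x ∈ A, q x) * ∏ x ∈ Aᶜ, (1 - q x) else 0

/-- The inclusion probabilities: `(1 - δ) p` for the odds (the elements of `O`) and `(1 + δ) p` for
the evens (the elements of `G \ O`). -/
noncomputable def biasedProb {G : Type*} [DecidableEq G] (O : Finset G) (δ p : ℝ) (x : G) : ℝ :=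
  if x ∈ O then (1 - δ) * p else (1 + δ) * p

/-- The event `B_k^O(A)`: there are `S ⊆ A ∩ (G \ O)` and `T ⊆ A ∩ O` with `|S| = k ≥ |T|` such
that `((A ∩ O) ∪ S) \ T` is sum-free. -/
def EventB {G : Type*} [AddCommGroup G] [Fintype G] [DecidableEq G] (O : Finset G) (k : ℕ)
    (A : Finset G) : Prop :=
  ∃ S T : Finset G, S ⊆ A ∩ Oᶜ ∧ T ⊆ A ∩ O ∧ S.card = k ∧ T.card ≤ k ∧
    SumFree (((A ∩ O) ∪ S) \ T)

end SumFreeThreshold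

namespace SumFreeThreshold

set_option linter.unusedSectionVars false

/-! Union bound over the even set `S`, with a graph attached to each `S`. Call a pair of odd
elements an edge for an even `s` if it forms a Schur triple with `s`: the pairs with sum `s` or
difference `s`. If `B_k` holds through `S` and `T`, every edge for `S` contained in `A` meets `T`
(`EventB.cover`), so a maximal matching among these edges has at most `k` members and every edge
disjoint from it is absent from `A`. Summing over matchings and bounding the absence of the
remaining edges by a Janson inequality proved by induction on edges (`ev_no_edge_le`) gives
`ev_cover_le`. With `u = n p²` and `k p` small, the cost of `S` is roughly `p^k (C u)^k exp(-p²
e(S))`, where `e(S)` counts edges.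

The constant `λ` comes from `e({s})`. Typically this is about `3n/2` (`n` differences, `n/2` sums),
but only about `n` when `2s = 0`. If `r(G) = βn` with `β` bounded below, the guarantee is `(4-β)n/4`
outside `2G`, and `n/2` on the boundedly many elements of `2G`. Since `p` is about `n^{-1/2}` up to
logarithms, `p ∑_s exp(-p² e({s}))` is under control precisely when `u/log n` exceeds `1/3`, `α -
1/2`, or `2/(4-β)` in the respective cases.

Edges of different elements of `S` may coincide, so edges are counted only over a transversal `S'`
of `S` for a suitable equivalence: congruence modulo `2G`, which makes edge sets disjoint, or
equality up to sign, which makes overlaps at most `2 r(G)`. The elements of `S` outside `S'` lie in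
few classes and are paid for by their factor `p` (`sum_le_of_transversal`, `sum_pow_mul_choose_le`).
What remains is polynomial in `u`; it is absorbed by interpolating the sharp exponent with a crude
one valid for all of `S` (`eventB_le_of_small`).

If `k p` is not small, Janson is applied to at most `1/p` elements of `S` at a reduced density. The
exponent is then of order `min(u k, n p)`, up to constants depending on `δ`, and beats the entropy
`(C n p / k)^{2k}` because `n p / k ≥ 1/δ` is large; this gives the `exp(-√n)` alternative
(`eventB_le_of_large`, `large_k_numerics`). -/

open Classical in
/-- The real-valued indicator of a proposition. -/
noncomputable def ind (P : Prop) : ℝ := if P then 1 else 0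

theorem ind_of {P : Prop} (h : P) : ind P = 1 := by simp [ind, h]
theorem ind_not {P : Prop} (h : ¬ P) : ind P = 0 := by simp [ind, h]
theorem ind_nonneg (P : Prop) : 0 ≤ ind P := by unfold ind; split_ifs <;> norm_num
theorem ind_le_one (P : Prop) : ind P ≤ 1 := by unfold ind; split_ifs <;> norm_num
theorem ind_mono {P Q : Prop} (h : P → Q) : ind P ≤ ind Q := by
  by_cases hP : P
  · rw [ind_of hP, ind_of (h hP)]
  · rw [ind_not hP]; exact ind_nonneg Q

/-! ### Product measures on subsets, and a Janson-type inequality -/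

section Expectation

variable {G : Type*} [Fintype G] [DecidableEq G]

/-- The expectation of `f A`, where `A` contains each `x` independently with probability `q x`. -/
noncomputable def ev (q : G → ℝ) (f : Finset G → ℝ) : ℝ :=
  ∑ A : Finset G, ((∏ x ∈ A, q x) * ∏ x ∈ Aᶜ, (1 - q x)) * f A

theorem randomSubsetProb_eq_ev (q : G → ℝ) (P : Finset G → Prop) :
    randomSubsetProb q P = ev q (fun A => ind (P A)) := by
  unfold randomSubsetProb ev ind
  refine Finset.sum_congr rfl fun A _ => ?_
  by_cases h : P A
  · simp only [h, if_true, mul_one]; congr!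
  · simp only [h, if_false, mul_zero]

theorem ev_mono {q : G → ℝ} (h0 : ∀ x, 0 ≤ q x) (h1 : ∀ x, q x ≤ 1) {f g : Finset G → ℝ}
    (h : ∀ A, f A ≤ g A) : ev q f ≤ ev q g := by
  refine Finset.sum_le_sum fun A _ => mul_le_mul_of_nonneg_left (h A) ?_
  exact mul_nonneg (Finset.prod_nonneg fun x _ => h0 x)
    (Finset.prod_nonneg fun x _ => by linarith [h1 x])

theorem ev_sub (q : G → ℝ) (f g : Finset G → ℝ) :
    ev q (fun A => f A - g A) = ev q f - ev q g := by
  simp [ev, mul_sub, Finset.sum_sub_distrib]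

theorem ev_sum {ι : Type*} (s : Finset ι) (q : G → ℝ) (f : ι → Finset G → ℝ) :
    ev q (fun A => ∑ i ∈ s, f i A) = ∑ i ∈ s, ev q (f i) := by
  simp only [ev, Finset.mul_sum]
  exact Finset.sum_comm

theorem ev_nonneg {q : G → ℝ} (h0 : ∀ x, 0 ≤ q x) (h1 : ∀ x, q x ≤ 1) {f : Finset G → ℝ}
    (h : ∀ A, 0 ≤ f A) : 0 ≤ ev q f := by
  have := ev_mono h0 h1 (f := fun _ => 0) (g := f) h
  simpa [ev] using this

theorem ev_eq_sum_erase (q : G → ℝ) (f : Finset G → ℝ) (a : G) :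
    ev q f = ∑ t ∈ (Finset.univ.erase a).powerset,
      ((∏ x ∈ t, q x) * ∏ x ∈ (Finset.univ.erase a) \ t, (1 - q x)) *
        (q a * f (insert a t) + (1 - q a) * f t) := by
  have hu : (Finset.univ : Finset (Finset G)) = (insert a (Finset.univ.erase a)).powerset := by
    rw [Finset.insert_erase (Finset.mem_univ a), Finset.powerset_univ]
  unfold ev
  rw [hu, Finset.sum_powerset_insert (Finset.notMem_erase a _), ← Finset.sum_add_distrib]
  refine Finset.sum_congr rfl fun t ht => ?_
  have hat : a ∉ t := fun h => Finset.notMem_erase a _ (Finset.mem_powerset.1 ht h)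
  have h1 : tᶜ = insert a (Finset.univ.erase a \ t) := by
    ext x; by_cases hx : x = a <;> simp [hx, hat]
  have h2 : (insert a t)ᶜ = Finset.univ.erase a \ t := by
    ext x; by_cases hx : x = a <;> simp [hx]
  rw [h2, h1, Finset.prod_insert hat, Finset.prod_insert (by simp)]
  ring

theorem ev_split (q : G → ℝ) (f : Finset G → ℝ) (a : G) :
    ev q f = q a * ev q (fun A => f (insert a A)) + (1 - q a) * ev q (fun A => f (A.erase a)) := by
  rw [ev_eq_sum_erase q f a, ev_eq_sum_erase q _ a, ev_eq_sum_erase q _ a, Finset.mul_sum,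
    Finset.mul_sum, ← Finset.sum_add_distrib]
  refine Finset.sum_congr rfl fun t ht => ?_
  have hat : a ∉ t := fun h => Finset.notMem_erase a _ (Finset.mem_powerset.1 ht h)
  simp only [Finset.insert_idem, Finset.erase_insert hat, Finset.erase_eq_of_notMem hat]
  ring

/-- Independence: conditioning on `F ⊆ A` amounts to adding `F` to a fresh random set. The elements
of `F` are exposed one at a time with `ev_split`. -/
theorem ev_ind_subset (q : G → ℝ) (F : Finset G) (g : Finset G → ℝ) :
    ev q (fun A => ind (F ⊆ A) * g A) = (∏ x ∈ F, q x) * ev q (fun A => g (A ∪ F)) := by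
  induction F using Finset.induction_on generalizing g with
  | empty => simp [ind]
  | insert a F ha ih =>
    rw [ev_split q _ a]
    have h0 : ev q (fun A => ind (insert a F ⊆ A.erase a) * g (A.erase a)) = 0 := by
      have : ∀ A : Finset G, ind (insert a F ⊆ A.erase a) = 0 := fun A =>
        ind_not fun h => Finset.notMem_erase a A (h (Finset.mem_insert_self a F))
      simp [this, ev]
    have h1 : ∀ A : Finset G, ind (insert a F ⊆ insert a A) = ind (F ⊆ A) := fun A => by
      congr 1
      refine propext ⟨fun h x hx => ?_, Finset.insert_subset_insert a⟩
      exact Finset.mem_of_mem_insert_of_ne (h (Finset.mem_insert_of_mem hx))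
        (fun e => ha (e ▸ hx))
    rw [h0, mul_zero, add_zero]
    simp only [h1]
    rw [ih (fun A => g (insert a A)), Finset.prod_insert ha, mul_assoc]
    simp only [Finset.union_insert]

theorem ev_update_le {q : G → ℝ} (h0 : ∀ x, 0 ≤ q x) (h1 : ∀ x, q x ≤ 1) {f : Finset G → ℝ}
    (hf : ∀ A B, A ⊆ B → f B ≤ f A) (a : G) {v : ℝ} (hv : v ≤ q a) :
    ev q f ≤ ev (Function.update q a v) f := by
  rw [ev_eq_sum_erase q f a, ev_eq_sum_erase _ f a]
  refine Finset.sum_le_sum fun t ht => ?_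
  have hat : a ∉ t := fun h => Finset.notMem_erase a _ (Finset.mem_powerset.1 ht h)
  have e1 : ∏ x ∈ t, Function.update q a v x = ∏ x ∈ t, q x :=
    Finset.prod_congr rfl fun x hx => by
      rw [Function.update_of_ne (ne_of_mem_of_not_mem hx hat)]
  have e2 : ∏ x ∈ Finset.univ.erase a \ t, (1 - Function.update q a v x)
      = ∏ x ∈ Finset.univ.erase a \ t, (1 - q x) :=
    Finset.prod_congr rfl fun x hx => by
      rw [Function.update_of_ne (Finset.ne_of_mem_erase (Finset.mem_sdiff.1 hx).1)]
  rw [e1, e2, Function.update_self]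
  refine mul_le_mul_of_nonneg_left ?_ (mul_nonneg (Finset.prod_nonneg fun x _ => h0 x)
    (Finset.prod_nonneg fun x _ => by linarith [h1 x]))
  nlinarith [hf t (insert a t) (Finset.subset_insert a t)]

/-- Lowering the inclusion probabilities one coordinate at a time can only increase the expectation
of a decreasing function. This permits Janson to be run at a uniform, possibly smaller, density. -/
theorem ev_le_ev_const {q : G → ℝ} {p : ℝ} (hp : 0 ≤ p) (hq : ∀ x, p ≤ q x) (h1 : ∀ x, q x ≤ 1)
    {f : Finset G → ℝ} (hf : ∀ A B, A ⊆ B → f B ≤ f A) : ev q f ≤ ev (fun _ => p) f := by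
  have key : ∀ s : Finset G, ev q f ≤ ev (fun x => if x ∈ s then p else q x) f := by
    intro s
    induction s using Finset.induction_on with
    | empty => simp
    | insert a s ha ih =>
      refine ih.trans ?_
      have e : (fun x => if x ∈ insert a s then p else q x) =
          Function.update (fun x => if x ∈ s then p else q x) a p := by
        ext x
        by_cases hx : x = a
        · subst hx; simp
        · simp [hx]
      rw [e]
      refine ev_update_le (fun x => ?_) (fun x => ?_) hf a ?_
      · split_ifs
        · exact hp
        · exact hp.trans (hq x)
      · split_ifs
        · exact (hq x).trans (h1 x)
        · exact h1 x
      · simp [ha, hq a]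
  simpa using key Finset.univ

/-- A Janson-type inequality for the number of edges spanned by a random set. -/
theorem ev_no_edge_le (p : ℝ) (hp : 0 ≤ p) (hp1 : p ≤ 1) (D : ℕ) (hD : D * p ≤ 1)
    (E : Finset (Finset G)) (h2 : ∀ e ∈ E, e.card = 2)
    (hE : ∀ e ∈ E, (E.filter fun f => f ≠ e ∧ ¬ Disjoint e f).card ≤ D) :
    ev (fun _ => p) (fun A => ind (∀ e ∈ E, ¬ e ⊆ A)) ≤
      Real.exp (-(E.card * (p ^ 2 * (1 - D * p)))) := by
  have q0 : ∀ x : G, 0 ≤ (fun _ : G => p) x := fun _ => hp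
  have q1 : ∀ x : G, (fun _ : G => p) x ≤ 1 := fun _ => hp1
  induction E using Finset.induction_on with
  | empty =>
    refine (ev_mono q0 q1 (g := fun A => ind (∅ ⊆ A) * 1) fun A => ?_).trans ?_
    · rw [ind_of (Finset.empty_subset A), mul_one]; exact ind_le_one _
    · rw [ev_ind_subset]
      have : ev (fun _ : G => p) (fun _ => 1) = 1 := by
        have := Finset.prod_add (fun _ : G => p) (fun _ => 1 - p) Finset.univ
        simp only [Finset.powerset_univ] at this
        simp only [ev, mul_one, Finset.compl_eq_univ_sdiff]
        rw [← this]; simp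
      simp [this]
  | insert e E he ih =>
    have hmono : ∀ g ∈ E, (E.filter fun f => f ≠ g ∧ ¬ Disjoint g f).card ≤ D := fun g hg =>
      (Finset.card_le_card (Finset.filter_subset_filter _ (Finset.subset_insert e E))).trans
        (hE g (Finset.mem_insert_of_mem hg))
    have ih' := ih (fun g hg => h2 g (Finset.mem_insert_of_mem hg)) hmono
    set h : Finset G → ℝ := fun A => ind (∀ f ∈ E, ¬ f ⊆ A) with hh
    -- `h1` ignores the edges meeting `e`, so it is independent of `e ⊆ A`. A union bound over the
    -- at most `D` ignored edges, each adding a third vertex and hence a factor `p`, shows that `e ⊆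
    -- A` and `h` hold together with probability at least `p²(1 - D p)` times that of `h1`, which
    -- dominates `h`. Each edge therefore contributes a factor `1 - p²(1 - D p)`.
    set h1 : Finset G → ℝ := fun A => ind (∀ f ∈ E, Disjoint e f → ¬ f ⊆ A) with hh1
    set N := E.filter fun f => ¬ Disjoint e f with hN
    have hcN : (N.card : ℝ) ≤ D := by
      have : N.card ≤ D := by
        refine (Finset.card_le_card ?_).trans (hE e (Finset.mem_insert_self e E))
        intro f hf
        rw [hN, Finset.mem_filter] at hf
        rw [Finset.mem_filter]
        exact ⟨Finset.mem_insert_of_mem hf.1, fun e' => he (e' ▸ hf.1), hf.2⟩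
      exact_mod_cast this
    have hle : ev (fun _ => p) h ≤ ev (fun _ => p) h1 :=
      ev_mono q0 q1 fun A => ind_mono fun H f hf _ => H f hf
    have hpos : 0 ≤ ev (fun _ => p) h1 := ev_nonneg q0 q1 fun A => ind_nonneg _
    have hpos' : 0 ≤ ev (fun _ => p) h := ev_nonneg q0 q1 fun A => ind_nonneg _
    have hanti : ∀ A B, A ⊆ B → h1 B ≤ h1 A := fun A B hAB =>
      ind_mono fun H f hf hd hfA => H f hf hd (hfA.trans hAB)
    have e1 : ev (fun _ => p) (fun A => ind (e ⊆ A) * h1 A) = p ^ 2 * ev (fun _ => p) h1 := by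
      rw [ev_ind_subset, Finset.prod_const, h2 e (Finset.mem_insert_self e E)]
      congr 2
      ext A
      simp only [hh1]
      congr 1
      refine propext (forall₂_congr fun f hf => forall_congr' fun hd => not_congr ?_)
      refine ⟨fun H x hx => ?_, fun H => H.trans Finset.subset_union_left⟩
      rcases Finset.mem_union.1 (H hx) with hx' | hx'
      · exact hx'
      · exact absurd hx (Finset.disjoint_left.1 hd hx')
    have e2 : ∀ f ∈ N, ev (fun _ => p) (fun A => ind (e ∪ f ⊆ A) * h1 A) ≤
        p ^ 3 * ev (fun _ => p) h1 := by
      intro f hf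
      rw [ev_ind_subset, Finset.prod_const]
      rw [hN, Finset.mem_filter] at hf
      have hc : 3 ≤ (e ∪ f).card := by
        by_contra hlt
        have h3 := h2 e (Finset.mem_insert_self e E)
        have h4 := h2 f (Finset.mem_insert_of_mem hf.1)
        have h5 : e = e ∪ f := Finset.eq_of_subset_of_card_le Finset.subset_union_left (by omega)
        have h6 : f = e ∪ f := Finset.eq_of_subset_of_card_le Finset.subset_union_right (by omega)
        exact he (by rw [h5, ← h6]; exact hf.1)
      exact mul_le_mul (pow_le_pow_of_le_one hp hp1 hc)
        (ev_mono q0 q1 fun A => hanti _ _ Finset.subset_union_left)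
        (ev_nonneg q0 q1 fun A => ind_nonneg _) (by positivity)
    have e3 : ev (fun _ => p) (fun A => ind (e ⊆ A) * h1 A - ∑ f ∈ N, ind (e ∪ f ⊆ A) * h1 A) ≤
        ev (fun _ => p) (fun A => ind (e ⊆ A) * h A) := by
      refine ev_mono q0 q1 fun A => ?_
      by_cases hA : e ⊆ A
      · rw [ind_of hA, one_mul, one_mul]
        have hs : ∀ f ∈ N, 0 ≤ ind (e ∪ f ⊆ A) * h1 A := fun f _ =>
          mul_nonneg (ind_nonneg _) (ind_nonneg _)
        by_cases hA1 : ∀ f ∈ E, Disjoint e f → ¬ f ⊆ A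
        · by_cases hA2 : ∀ f ∈ E, ¬ f ⊆ A
          · simp only [hh, ind_of hA2]
            linarith [Finset.sum_nonneg hs, ind_le_one (∀ f ∈ E, Disjoint e f → ¬ f ⊆ A)]
          · push Not at hA2
            obtain ⟨f, hf, hfA⟩ := hA2
            have hfN : f ∈ N := by
              rw [hN, Finset.mem_filter]
              exact ⟨hf, fun hd => hA1 f hf hd hfA⟩
            have := Finset.single_le_sum hs hfN
            rw [ind_of (Finset.union_subset hA hfA), one_mul] at this
            linarith [ind_nonneg (∀ f ∈ E, ¬ f ⊆ A)]
        · have : h1 A = 0 := ind_not hA1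
          rw [this]; simp [hh, ind_nonneg]
      · have : ∀ f, ind (e ∪ f ⊆ A) = 0 := fun f =>
          ind_not fun H => hA (Finset.subset_union_left.trans H)
        simp [ind_not hA, this]
    rw [ev_sub, ev_sum, e1] at e3
    have e4 : ∑ f ∈ N, ev (fun _ => p) (fun A => ind (e ∪ f ⊆ A) * h1 A) ≤
        D * (p ^ 3 * ev (fun _ => p) h1) := by
      refine (Finset.sum_le_sum e2).trans ?_
      rw [Finset.sum_const, nsmul_eq_mul]
      exact mul_le_mul_of_nonneg_right hcN (by positivity)
    have e5 : p ^ 2 * (1 - D * p) * ev (fun _ => p) h ≤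
        ev (fun _ => p) (fun A => ind (e ⊆ A) * h A) := by
      have : p ^ 2 * (1 - D * p) * ev (fun _ => p) h ≤ p ^ 2 * (1 - D * p) * ev (fun _ => p) h1 :=
        mul_le_mul_of_nonneg_left hle (mul_nonneg (by positivity) (by linarith))
      nlinarith
    have e6 : ev (fun _ => p) (fun A => ind (∀ f ∈ insert e E, ¬ f ⊆ A)) =
        ev (fun _ => p) h - ev (fun _ => p) (fun A => ind (e ⊆ A) * h A) := by
      rw [← ev_sub]
      congr 1
      ext A
      by_cases hA : e ⊆ A
      · rw [ind_of hA, ind_not]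
        · ring
        · exact fun H => H e (Finset.mem_insert_self e E) hA
      · rw [ind_not hA, zero_mul, sub_zero]
        simp only [hh, Finset.forall_mem_insert, hA, not_false_eq_true, true_and]
    rw [e6, Finset.card_insert_of_notMem he]
    have e7 : (1 : ℝ) - p ^ 2 * (1 - D * p) ≤ Real.exp (-(p ^ 2 * (1 - D * p))) := by
      linarith [Real.add_one_le_exp (-(p ^ 2 * (1 - D * p)))]
    calc _ ≤ (1 - p ^ 2 * (1 - D * p)) * ev (fun _ => p) h := by linarith
      _ ≤ Real.exp (-(p ^ 2 * (1 - D * p))) * Real.exp (-(E.card * (p ^ 2 * (1 - D * p)))) :=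
        mul_le_mul e7 ih' hpos' (Real.exp_pos _).le
      _ = _ := by rw [← Real.exp_add]; congr 1; push_cast; ring

end Expectation

/-! ### From small vertex covers to maximal matchings -/

section Cover

variable {G : Type*} [DecidableEq G]

theorem exists_maximal_disjoint_family (E : Finset (Finset G)) :
    ∃ M ⊆ E, (M : Set (Finset G)).PairwiseDisjoint id ∧
      ∀ e ∈ E, e.Nonempty → ¬ Disjoint e (M.biUnion id) := by
  classical
  obtain ⟨M, hM, hmax⟩ := (E.powerset.filter fun M : Finset (Finset G) =>
    (M : Set (Finset G)).PairwiseDisjoint id).exists_max_image Finset.card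
      ⟨∅, by simp⟩
  rw [Finset.mem_filter, Finset.mem_powerset] at hM
  refine ⟨M, hM.1, hM.2, fun e he hne hd => ?_⟩
  have heM : e ∉ M := fun h => by
    have h1 : e ⊆ M.biUnion id := Finset.subset_biUnion_of_mem id h
    have h2 := Finset.disjoint_of_subset_right h1 hd
    rw [Finset.disjoint_self_iff_empty] at h2
    exact hne.ne_empty h2
  have := hmax (insert e M) (by
    rw [Finset.mem_filter, Finset.mem_powerset]
    refine ⟨Finset.insert_subset he hM.1, ?_⟩
    rw [Finset.coe_insert]
    refine hM.2.insert fun f hf _ => ?_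
    exact Finset.disjoint_of_subset_right (Finset.subset_biUnion_of_mem id hf) hd)
  rw [Finset.card_insert_of_notMem heM] at this
  omega

theorem card_le_of_disjoint_family {M : Finset (Finset G)}
    (hM : (M : Set (Finset G)).PairwiseDisjoint id) {T : Finset G}
    (hT : ∀ e ∈ M, ¬ Disjoint e T) : M.card ≤ T.card := by
  have hT' : ∀ e ∈ M, ∃ x, x ∈ e ∧ x ∈ T := fun e he => Finset.not_disjoint_iff.1 (hT e he)
  rcases M.eq_empty_or_nonempty with rfl | ⟨e₀, he₀⟩
  · simp
  have : Nonempty G := ⟨(hT' e₀ he₀).choose⟩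
  choose! φ h1 h2 using hT'
  refine Finset.card_le_card_of_injOn φ (fun e he => h2 e he) fun e he f hf hef => ?_
  by_contra hne
  exact Finset.disjoint_left.1 (hM he hf hne) (h1 e he) (hef ▸ h1 f hf)

theorem card_biUnion_of_edges {M : Finset (Finset G)}
    (hM : (M : Set (Finset G)).PairwiseDisjoint id) (h2 : ∀ e ∈ M, e.card = 2) :
    (M.biUnion id).card = 2 * M.card := by
  rw [Finset.card_biUnion hM, Finset.sum_congr (g := fun _ => 2) rfl fun e he => by simp [h2 e he]]
  simp [mul_comm]

theorem card_filter_not_disjoint_le (E : Finset (Finset G)) {d : ℕ}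
    (hd : ∀ a : G, (E.filter fun e => a ∈ e).card ≤ d) (W : Finset G) :
    (E.filter fun e => ¬ Disjoint e W).card ≤ W.card * d := by
  have : E.filter (fun e => ¬ Disjoint e W) ⊆ W.biUnion fun a => E.filter fun e => a ∈ e := by
    intro e he
    rw [Finset.mem_filter, Finset.not_disjoint_iff] at he
    obtain ⟨he, x, hx, hxW⟩ := he
    exact Finset.mem_biUnion.2 ⟨x, hxW, Finset.mem_filter.2 ⟨he, hx⟩⟩
  exact (Finset.card_le_card this).trans (Finset.card_biUnion_le_card_mul _ _ _ fun a _ => hd a)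

/-- The probability that a random set contains `S` and that all the edges it spans can be covered
by at most `k` vertices. -/
theorem ev_cover_le [Fintype G] {O : Finset G} {q : G → ℝ} {a b p : ℝ} (hp : 0 ≤ p) (hpa : p ≤ a)
    (hab : a ≤ b) (hb : b ≤ 1) (hqO : ∀ x ∈ O, q x = a) (hqE : ∀ x ∉ O, q x = b)
    {k : ℕ} {S : Finset G} (hS : S ⊆ Oᶜ) (hSk : S.card = k)
    (E : Finset (Finset G)) (h2 : ∀ e ∈ E, e.card = 2) (hEO : ∀ e ∈ E, e ⊆ O)
    {d : ℕ} (hd : ∀ a : G, (E.filter fun e => a ∈ e).card ≤ d) (hdp : 2 * d * p ≤ 1) :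
    ev q (fun A => ind (S ⊆ A ∧ ∃ T : Finset G, T.card ≤ k ∧ ∀ e ∈ E, e ⊆ A → ¬ Disjoint e T)) ≤
      b ^ k * ((∑ i ∈ Finset.range (k + 1), (E.card.choose i : ℝ) * a ^ (2 * i)) *
        Real.exp (-((E.card - 2 * k * d) * (p ^ 2 * (1 - 2 * d * p))))) := by
  classical
  have ha : 0 ≤ a := hp.trans hpa
  have hq0 : ∀ x, p ≤ q x := fun x => by
    by_cases hx : x ∈ O
    · rw [hqO x hx]; exact hpa
    · rw [hqE x hx]; exact hpa.trans hab
  have hq1 : ∀ x, q x ≤ 1 := fun x => by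
    by_cases hx : x ∈ O
    · rw [hqO x hx]; exact hab.trans hb
    · rw [hqE x hx]; exact hb
  have hq0' : ∀ x, 0 ≤ q x := fun x => hp.trans (hq0 x)
  set X := Real.exp (-((E.card - 2 * k * d) * (p ^ 2 * (1 - 2 * d * p)))) with hX
  set MM := E.powerset.filter fun M : Finset (Finset G) =>
    (M : Set (Finset G)).PairwiseDisjoint id ∧ M.card ≤ k with hMM
  set E' : Finset (Finset G) → Finset (Finset G) := fun M =>
    E.filter fun e => Disjoint e (M.biUnion id) with hE'
  have step1 : ∀ A : Finset G,
      ind (S ⊆ A ∧ ∃ T : Finset G, T.card ≤ k ∧ ∀ e ∈ E, e ⊆ A → ¬ Disjoint e T) ≤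
      ∑ M ∈ MM, ind (S ∪ M.biUnion id ⊆ A) * ind (∀ e ∈ E' M, ¬ e ⊆ A) := by
    intro A
    have hnn : ∀ M ∈ MM, 0 ≤ ind (S ∪ M.biUnion id ⊆ A) * ind (∀ e ∈ E' M, ¬ e ⊆ A) :=
      fun M _ => mul_nonneg (ind_nonneg _) (ind_nonneg _)
    by_cases H : S ⊆ A ∧ ∃ T : Finset G, T.card ≤ k ∧ ∀ e ∈ E, e ⊆ A → ¬ Disjoint e T
    · obtain ⟨hSA, T, hTk, hT⟩ := H
      -- A cover by `k` vertices meets the disjoint edges of `M` in distinct vertices, whence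
      -- `M.card ≤ k`; maximality forbids edges of `A` disjoint from `M`.
      obtain ⟨M, hME, hMd, hMax⟩ := exists_maximal_disjoint_family (E.filter fun e => e ⊆ A)
      have hMA : ∀ e ∈ M, e ∈ E ∧ e ⊆ A := fun e he => Finset.mem_filter.1 (hME he)
      have hMk : M.card ≤ k :=
        (card_le_of_disjoint_family hMd fun e he => hT e (hMA e he).1 (hMA e he).2).trans hTk
      have hM : M ∈ MM := by
        rw [hMM, Finset.mem_filter, Finset.mem_powerset]
        exact ⟨fun e he => (hMA e he).1, hMd, hMk⟩
      refine le_trans ?_ (Finset.single_le_sum hnn hM)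
      rw [ind_of (P := S ∪ M.biUnion id ⊆ A), ind_of (P := ∀ e ∈ E' M, ¬ e ⊆ A), mul_one]
      · exact ind_le_one _
      · intro e he heA
        rw [hE', Finset.mem_filter] at he
        refine hMax e (Finset.mem_filter.2 ⟨he.1, heA⟩) ?_ he.2
        rw [← Finset.card_pos, h2 e he.1]; norm_num
      · exact Finset.union_subset hSA (Finset.biUnion_subset.2 fun e he => (hMA e he).2)
    · rw [ind_not H]
      exact Finset.sum_nonneg hnn
  have step2 : ∀ M ∈ MM, ev q (fun A => ind (S ∪ M.biUnion id ⊆ A) *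
      ind (∀ e ∈ E' M, ¬ e ⊆ A)) ≤ b ^ k * (a ^ (2 * M.card) * X) := by
    intro M hM
    rw [hMM, Finset.mem_filter, Finset.mem_powerset] at hM
    obtain ⟨hME, hMd, hMk⟩ := hM
    have hVO : M.biUnion id ⊆ O := Finset.biUnion_subset.2 fun e he => hEO e (hME he)
    have hVc := card_biUnion_of_edges hMd fun e he => h2 e (hME he)
    have hdisj : Disjoint S (M.biUnion id) := by
      rw [Finset.disjoint_left]
      exact fun x hx hx' => Finset.mem_compl.1 (hS hx) (hVO hx')
    rw [ev_ind_subset, Finset.prod_union hdisj,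
      Finset.prod_congr rfl (fun x hx => hqE x (Finset.mem_compl.1 (hS hx))),
      Finset.prod_congr rfl (fun x hx => hqO x (hVO hx)), Finset.prod_const, Finset.prod_const,
      hSk, hVc, mul_assoc]
    refine mul_le_mul_of_nonneg_left ?_ (pow_nonneg (ha.trans hab) _)
    refine mul_le_mul_of_nonneg_left ?_ (pow_nonneg ha _)
    calc ev q (fun A => ind (∀ e ∈ E' M, ¬ e ⊆ A ∪ (S ∪ M.biUnion id)))
        ≤ ev q (fun A => ind (∀ e ∈ E' M, ¬ e ⊆ A)) :=
          ev_mono hq0' hq1 fun A => ind_mono fun H e he heA =>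
            H e he (heA.trans Finset.subset_union_left)
      _ ≤ ev (fun _ => p) (fun A => ind (∀ e ∈ E' M, ¬ e ⊆ A)) :=
          ev_le_ev_const hp hq0 hq1 fun A B hAB => ind_mono fun H e he heA =>
            H e he (heA.trans hAB)
      _ ≤ Real.exp (-((E' M).card * (p ^ 2 * (1 - (2 * d : ℕ) * p)))) := by
          -- An edge has two endpoints, each in at most `d` edges, hence the parameter `2 * d`.
          refine ev_no_edge_le p hp (hpa.trans (hab.trans hb)) (2 * d) (by push_cast; exact hdp)
            _ (fun e he => h2 e (Finset.mem_filter.1 he).1) fun e he => ?_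
          rw [← h2 e (Finset.mem_filter.1 he).1]
          refine (Finset.card_le_card ?_).trans (card_filter_not_disjoint_le E hd e)
          intro f hf
          rw [Finset.mem_filter] at hf ⊢
          exact ⟨(Finset.mem_filter.1 hf.1).1, fun h => hf.2.2 h.symm⟩
      _ ≤ X := by
          rw [hX, Real.exp_le_exp]
          push_cast
          -- The matching has at most `2k` vertices, and each removes at most `d` edges.
          have hc : (E.card : ℝ) - 2 * k * d ≤ (E' M).card := by
            have h3 := Finset.card_filter_add_card_filter_not (s := E)
              (fun e => Disjoint e (M.biUnion id))
            have h4 := card_filter_not_disjoint_le E hd (M.biUnion id)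
            rw [hVc] at h4
            have h5 : E.card ≤ (E' M).card + 2 * k * d := by
              have : 2 * M.card * d ≤ 2 * k * d := by gcongr
              simp only [hE']; omega
            have : (E.card : ℝ) ≤ (E' M).card + 2 * k * d := by exact_mod_cast h5
            linarith
          have : 0 ≤ p ^ 2 * (1 - 2 * d * p) := mul_nonneg (by positivity) (by linarith)
          nlinarith [mul_le_mul_of_nonneg_right hc this]
  calc _ ≤ ev q (fun A => ∑ M ∈ MM, ind (S ∪ M.biUnion id ⊆ A) * ind (∀ e ∈ E' M, ¬ e ⊆ A)) :=
        ev_mono hq0' hq1 step1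
    _ ≤ ∑ M ∈ MM, b ^ k * (a ^ (2 * M.card) * X) := by
        rw [ev_sum]; exact Finset.sum_le_sum step2
    -- Disjointness of the family is dropped: only its size matters for the count.
    _ ≤ ∑ M ∈ (Finset.range (k + 1)).biUnion fun i => E.powersetCard i,
          b ^ k * (a ^ (2 * M.card) * X) := by
        refine Finset.sum_le_sum_of_subset_of_nonneg (fun M hM => ?_) fun M _ _ => ?_
        · rw [hMM, Finset.mem_filter, Finset.mem_powerset] at hM
          exact Finset.mem_biUnion.2 ⟨M.card, Finset.mem_range.2 (by omega),
            Finset.mem_powersetCard.2 ⟨hM.1, rfl⟩⟩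
        · exact mul_nonneg (pow_nonneg (ha.trans hab) _)
            (mul_nonneg (pow_nonneg ha _) (Real.exp_pos _).le)
    _ = _ := by
        rw [Finset.sum_biUnion, Finset.sum_mul, Finset.mul_sum]
        · refine Finset.sum_congr rfl fun i _ => ?_
          rw [Finset.sum_congr rfl (g := fun _ => b ^ k * (a ^ (2 * i) * X)) fun M hM => by
            rw [(Finset.mem_powersetCard.1 hM).2], Finset.sum_const, Finset.card_powersetCard,
            nsmul_eq_mul]
          ring
        · intro i _ j _ hij
          exact Finset.pairwise_disjoint_powersetCard E hij

end Cover
/-- `O` is the set of odd elements for some index-two subgroup. -/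
def OddCoset {G : Type*} [AddCommGroup G] (O : Finset G) : Prop :=
  ∀ x y, x + y ∈ O ↔ ¬ (x ∈ O ↔ y ∈ O)

/-! ### Maximum sum-free sets are odd cosets -/

section MaximumSumFree

variable {G : Type*} [AddCommGroup G] [Fintype G] [DecidableEq G]

theorem two_mul_card_le_of_sumFree {B : Finset G} (hB : SumFree B) :
    2 * B.card ≤ Fintype.card G := by
  rcases B.eq_empty_or_nonempty with rfl | ⟨x, hx⟩
  · simp
  have hd : Disjoint B (B.map (addLeftEmbedding x)) := by
    rw [Finset.disjoint_left]
    rintro y hy hy'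
    obtain ⟨z, hz, rfl⟩ := Finset.mem_map.1 hy'
    exact hB x hx z hz hy
  have := Finset.card_le_univ (B ∪ B.map (addLeftEmbedding x))
  rw [Finset.card_union_of_disjoint hd, Finset.card_map] at this
  omega

/-- Even order gives an element of order two, so doubling is not surjective and `G/2G` is a nonzero
vector space over `ZMod 2`. A linear functional nonzero somewhere on it pulls back to a parity on
`G`, whose odd elements form the required set. -/
theorem exists_sumFree_card {n : ℕ} (hG : Fintype.card G = 2 * n) :
    ∃ C : Finset G, SumFree C ∧ C.card = n := by
  classical
  have hns : ¬ Function.Surjective (nsmulAddMonoidHom 2 : G →+ G) := by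
    intro h
    have hinj := Finite.injective_iff_surjective.2 h
    obtain ⟨x, hx⟩ := exists_prime_addOrderOf_dvd_card 2 (hG ▸ dvd_mul_right 2 n)
    have h0 : (nsmulAddMonoidHom 2 : G →+ G) x = nsmulAddMonoidHom 2 0 := by
      simp [← hx, addOrderOf_nsmul_eq_zero]
    rw [hinj h0, addOrderOf_zero] at hx
    omega
  rw [← AddMonoidHom.range_eq_top] at hns
  obtain ⟨v, hv⟩ : ∃ v : G, v ∉ (nsmulAddMonoidHom 2 : G →+ G).range := by
    by_contra! h
    exact hns (eq_top_iff.2 fun x _ => h x)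
  set R := (nsmulAddMonoidHom 2 : G →+ G).range
  have h2 : ∀ x : G ⧸ R, 2 • x = 0 := fun x => by
    induction x using QuotientAddGroup.induction_on with
    | H z =>
      rw [← QuotientAddGroup.mk_nsmul, QuotientAddGroup.eq_zero_iff]
      exact ⟨z, rfl⟩
  let _ := AddCommGroup.zmodModule h2
  have hv' : (v : G ⧸ R) ≠ 0 := fun h => hv ((QuotientAddGroup.eq_zero_iff v).1 h)
  obtain ⟨φ, hφ⟩ : ∃ φ : Module.Dual (ZMod 2) (G ⧸ R), φ (v : G ⧸ R) ≠ 0 := by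
    by_contra! h
    exact hv' ((Module.forall_dual_apply_eq_zero_iff (ZMod 2) _).1 h)
  set f : G → ZMod 2 := fun x => φ (x : G ⧸ R) with hf
  have hadd : ∀ x y, f (x + y) = f x + f y := fun x y => by simp [hf]
  have hdich : ∀ a : ZMod 2, a = 0 ∨ a = 1 := by decide
  have hv1 : f v = 1 := (hdich _).resolve_left hφ
  have h11 : (1 : ZMod 2) + 1 = 0 := by decide
  refine ⟨Finset.univ.filter fun x => f x = 1, fun x hx y hy h => ?_, ?_⟩
  · simp only [Finset.mem_filter, Finset.mem_univ, true_and] at hx hy h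
    rw [hadd, hx, hy] at h
    exact absurd h (by decide)
  · have hcard : (Finset.univ.filter fun x => f x = 1).card =
        (Finset.univ.filter fun x => ¬ f x = 1).card := by
      refine Finset.card_bij' (fun x _ => x + v) (fun x _ => x - v) ?_ ?_ ?_ ?_
      · intro x hx
        simp only [Finset.mem_filter, Finset.mem_univ, true_and] at hx ⊢
        rw [hadd, hx, hv1]; decide
      · intro x hx
        simp only [Finset.mem_filter, Finset.mem_univ, true_and] at hx ⊢
        have h3 := hadd (x - v) v
        rw [sub_add_cancel, hv1, (hdich _).resolve_right hx] at h3
        rcases hdich (f (x - v)) with h4 | h4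
        · rw [h4] at h3; exact absurd h3 (by decide)
        · exact h4
      · simp
      · simp
    have := Finset.card_filter_add_card_filter_not (s := (Finset.univ : Finset G))
      (fun x => f x = 1)
    rw [Finset.card_univ, hG] at this
    omega

theorem oddCoset_of_mem_SF {n : ℕ} (hn : 1 ≤ n) (hG : Fintype.card G = 2 * n) {O : Finset G}
    (hO : O ∈ SF (Finset.univ : Finset G)) : OddCoset O ∧ O.card = n := by
  obtain ⟨-, hsf, hmax⟩ := hO
  obtain ⟨C, hC, hCn⟩ := exists_sumFree_card hG
  have h1 := hmax C (Finset.subset_univ _) hC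
  have h2 := two_mul_card_le_of_sumFree hsf
  have hOn : O.card = n := by omega
  -- Sum-freeness puts `x + O` inside the complement, and both have `n` elements. This equality is
  -- the parity rule.
  have himg : ∀ x ∈ O, O.map (addLeftEmbedding x) = Oᶜ := fun x hx => by
    refine Finset.eq_of_subset_of_card_le (fun y hy => ?_) ?_
    · obtain ⟨z, hz, rfl⟩ := Finset.mem_map.1 hy
      exact Finset.mem_compl.2 (hsf x hx z hz)
    · rw [Finset.card_compl, Finset.card_map, hG]; omega
  have key : ∀ x ∈ O, ∀ y, x + y ∈ O ↔ y ∉ O := fun x hx y => by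
    constructor
    · exact fun h hy => hsf x hx y hy h
    · intro hy
      by_contra h
      rw [← Finset.mem_compl, ← himg x hx] at h
      obtain ⟨z, hz, hzy⟩ := Finset.mem_map.1 h
      exact hy (add_left_cancel (hzy : x + z = x + y) ▸ hz)
  refine ⟨fun x y => ?_, hOn⟩
  by_cases hx : x ∈ O
  · simp [key x hx, hx]
  by_cases hy : y ∈ O
  · simp [add_comm x y, key y hy, hx, hy]
  · obtain ⟨o, ho⟩ : O.Nonempty := by rw [← Finset.card_pos]; omega
    have h3 : o + x ∈ O := (key o ho x).2 hx
    have h4 : o + x + y ∈ O := (key _ h3 y).2 hy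
    rw [add_assoc, key o ho] at h4
    simp [hx, hy, h4]

end MaximumSumFree

/-! ### The graph of Schur triples: degrees, edge counts and overlaps -/

section Graph

variable {G : Type*} [AddCommGroup G] [DecidableEq G]

/-- The pairs of odd elements with sum `s`, apart from some degenerate ones. -/
def sumEdges (O : Finset G) (s : G) : Finset (Finset G) :=
  (O.filter fun x => x + x ≠ s ∧ x + x ≠ 0 ∧ x + x ≠ s + s).image fun x => {x, s - x}

/-- The pairs of odd elements with difference `s`. -/
def diffEdges (O : Finset G) (s : G) : Finset (Finset G) :=
  O.image fun x => {x, x + s}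

/-- The pairs of odd elements that form a Schur triple with `s`. -/
def schurEdges (O : Finset G) (s : G) : Finset (Finset G) := sumEdges O s ∪ diffEdges O s

/-- The pairs of odd elements that form a Schur triple with an element of `S`. -/
def schurGraph (O S : Finset G) : Finset (Finset G) := S.biUnion (schurEdges O)

variable {O : Finset G}

theorem OddCoset.zero_notMem (hO : OddCoset O) : (0 : G) ∉ O := by
  have := hO 0 0
  simpa using this

theorem OddCoset.neg_mem (hO : OddCoset O) {x : G} (hx : x ∈ O) : -x ∈ O := by
  have := hO x (-x)
  simp only [add_neg_cancel, hO.zero_notMem, hx, true_iff, false_iff, not_not] at this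
  exact this

theorem OddCoset.add_mem (hO : OddCoset O) {x s : G} (hx : x ∈ O) (hs : s ∉ O) : x + s ∈ O := by
  rw [hO]; simp [hx, hs]

theorem OddCoset.sub_mem (hO : OddCoset O) {x s : G} (hx : x ∈ O) (hs : s ∉ O) : s - x ∈ O := by
  rw [sub_eq_add_neg, add_comm]; exact hO.add_mem (hO.neg_mem hx) hs

theorem pair_eq_pair {a b c d : G} (h : ({a, b} : Finset G) = {c, d}) :
    (a = c ∧ b = d) ∨ (a = d ∧ b = c) := by
  have := congrArg (fun s : Finset G => (s : Set G)) h
  simp only [Finset.coe_pair] at this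
  exact Set.pair_eq_pair_iff.1 this

theorem mem_sumEdges {s : G} {e : Finset G} (he : e ∈ sumEdges O s) :
    ∃ x ∈ O, x + x ≠ s ∧ x + x ≠ 0 ∧ x + x ≠ s + s ∧ e = {x, s - x} := by
  obtain ⟨x, hx, rfl⟩ := Finset.mem_image.1 he
  rw [Finset.mem_filter] at hx
  exact ⟨x, hx.1, hx.2.1, hx.2.2.1, hx.2.2.2, rfl⟩

theorem mem_diffEdges {s : G} {e : Finset G} (he : e ∈ diffEdges O s) :
    ∃ x ∈ O, e = {x, x + s} := by
  obtain ⟨x, hx, rfl⟩ := Finset.mem_image.1 he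
  exact ⟨x, hx, rfl⟩

theorem schurEdges_card_eq {s : G} (hs0 : s ≠ 0) {e : Finset G} (he : e ∈ schurEdges O s) :
    e.card = 2 := by
  rcases Finset.mem_union.1 he with he | he
  · obtain ⟨x, -, h1, -, -, rfl⟩ := mem_sumEdges he
    exact Finset.card_pair fun h => h1 (by rw [eq_sub_iff_add_eq] at h; exact h)
  · obtain ⟨x, -, rfl⟩ := mem_diffEdges he
    exact Finset.card_pair fun h => hs0 (by simpa using h)

theorem schurEdges_subset (hO : OddCoset O) {s : G} (hs : s ∉ O) {e : Finset G}
    (he : e ∈ schurEdges O s) : e ⊆ O := by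
  rcases Finset.mem_union.1 he with he | he
  · obtain ⟨x, hx, -, -, -, rfl⟩ := mem_sumEdges he
    simp [Finset.insert_subset_iff, hx, hO.sub_mem hx hs]
  · obtain ⟨x, hx, rfl⟩ := mem_diffEdges he
    simp [Finset.insert_subset_iff, hx, hO.add_mem hx hs]

/-- The only possible neighbours of `a` are `s - a`, `a + s` and `a - s`. -/
theorem schurEdges_degree_le (s a : G) :
    ((schurEdges O s).filter fun e => a ∈ e).card ≤ 3 := by
  have : (schurEdges O s).filter (fun e => a ∈ e) ⊆ {{a, s - a}, {a, a + s}, {a - s, a}} := by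
    intro e he
    obtain ⟨he, hae⟩ := Finset.mem_filter.1 he
    rcases Finset.mem_union.1 he with he | he
    · obtain ⟨x, -, -, -, -, rfl⟩ := mem_sumEdges he
      rcases Finset.mem_insert.1 hae with rfl | h
      · simp
      · rw [Finset.mem_singleton] at h
        subst h
        simp [Finset.pair_comm x]
    · obtain ⟨x, -, rfl⟩ := mem_diffEdges he
      rcases Finset.mem_insert.1 hae with rfl | h
      · simp
      · rw [Finset.mem_singleton] at h
        subst h
        simp
  exact (Finset.card_le_card this).trans Finset.card_le_three

theorem schurGraph_degree_le (S : Finset G) (a : G) :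
    ((schurGraph O S).filter fun e => a ∈ e).card ≤ 3 * S.card := by
  rw [schurGraph, Finset.filter_biUnion, mul_comm]
  exact Finset.card_biUnion_le_card_mul _ _ _ fun s _ => schurEdges_degree_le s a

theorem card_schurEdges_le (s : G) : (schurEdges O s).card ≤ 2 * O.card := by
  refine (Finset.card_union_le _ _).trans ?_
  have h1 : (sumEdges O s).card ≤ O.card :=
    Finset.card_image_le.trans (Finset.card_filter_le _ _)
  have h2 : (diffEdges O s).card ≤ O.card := Finset.card_image_le
  omega

theorem card_schurGraph_le (S : Finset G) : (schurGraph O S).card ≤ 2 * O.card * S.card := by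
  rw [mul_comm]
  exact Finset.card_biUnion_le_card_mul _ _ _ fun s _ => card_schurEdges_le s

/-- A pair `{x, s - x}` is also a difference pair only if `2x = 0` or `2x = 2s`. These are exactly
the exclusions in `sumEdges` beyond the loop condition `2x = s`, so the two counts simply add. -/
theorem disjoint_sumEdges_diffEdges (s : G) : Disjoint (sumEdges O s) (diffEdges O s) := by
  rw [Finset.disjoint_left]
  intro e he he'
  obtain ⟨x, -, -, h0, h2, rfl⟩ := mem_sumEdges he
  obtain ⟨y, -, hy⟩ := mem_diffEdges he'
  rcases pair_eq_pair hy with ⟨rfl, h⟩ | ⟨rfl, h⟩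
  · apply h0
    have h3 : -x = x := by
      rw [sub_eq_add_neg, add_comm] at h
      exact add_right_cancel h
    rw [← sub_eq_zero] at h3
    rw [← neg_eq_zero, ← h3]; abel
  · apply h2
    rw [sub_eq_iff_eq_add] at h
    have : y + y = 0 := by
      have h3 : s + 0 = s + (y + y) := by rw [add_zero]; exact h.trans (by abel)
      exact (add_left_cancel h3).symm
    calc y + s + (y + s) = (y + y) + (s + s) := by abel
      _ = s + s := by rw [this, zero_add]

theorem card_schurEdges (s : G) :
    (schurEdges O s).card = (sumEdges O s).card + (diffEdges O s).card :=
  Finset.card_union_of_disjoint (disjoint_sumEdges_diffEdges s)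

theorem card_filter_le_two_mul_sumEdges (s : G) :
    (O.filter fun x => x + x ≠ s ∧ x + x ≠ 0 ∧ x + x ≠ s + s).card ≤ 2 * (sumEdges O s).card := by
  refine Finset.card_le_mul_card_image _ 2 fun e he => ?_
  obtain ⟨x, -, rfl⟩ := Finset.mem_image.1 he
  refine (Finset.card_le_card (t := {x, s - x}) fun y hy => ?_).trans Finset.card_le_two
  rw [Finset.mem_filter] at hy
  rw [← hy.2]; simp

theorem card_le_two_mul_diffEdges (s : G) : O.card ≤ 2 * (diffEdges O s).card := by
  refine Finset.card_le_mul_card_image _ 2 fun e he => ?_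
  obtain ⟨x, -, rfl⟩ := Finset.mem_image.1 he
  refine (Finset.card_le_card (t := {x, x + s}) fun y hy => ?_).trans Finset.card_le_two
  rw [Finset.mem_filter] at hy
  rw [← hy.2]; simp

/-- The pair `{x, x + s}` could also arise from `x + s` only if `2s = 0`. Elements of order two lose
half of their difference edges in this way. -/
theorem card_diffEdges {s : G} (hs : s + s ≠ 0) : (diffEdges O s).card = O.card := by
  refine Finset.card_image_of_injective _ fun x y hxy => ?_
  rcases pair_eq_pair hxy with ⟨h, -⟩ | ⟨rfl, h⟩
  · exact h
  · rw [add_assoc, add_eq_left] at h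
    exact absurd h hs

theorem card_odd_le (s : G) : O.card ≤
    (O.filter fun x => x + x ≠ s ∧ x + x ≠ 0 ∧ x + x ≠ s + s).card +
      (O.filter fun x => x + x = s).card + (O.filter fun x => x + x = 0 ∨ x + x = s + s).card := by
  refine (Finset.card_le_card (t := (O.filter fun x => x + x ≠ s ∧ x + x ≠ 0 ∧ x + x ≠ s + s) ∪
      (O.filter fun x => x + x = s) ∪ (O.filter fun x => x + x = 0 ∨ x + x = s + s))
      fun x hx => ?_).trans ?_
  · simp only [Finset.mem_union, Finset.mem_filter, hx, true_and]
    tauto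
  · exact (Finset.card_union_le _ _).trans (Nat.add_le_add_right (Finset.card_union_le _ _) _)

theorem card_filter_add_self_eq_add_self_le (hO : OddCoset O) {s : G} (hs : s ∉ O) :
    (O.filter fun x => x + x = s + s).card ≤ (O.filter fun x => x + x = 0).card := by
  have hs' : -s ∉ O := fun h => hs (by simpa using hO.neg_mem h)
  refine Finset.card_le_card_of_injOn (fun x => x + -s) (fun x hx => ?_)
    (fun x _ y _ h => add_right_cancel h)
  rw [Finset.mem_coe, Finset.mem_filter] at hx ⊢
  refine ⟨hO.add_mem hx.1 hs', ?_⟩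
  calc x + -s + (x + -s) = x + x - (s + s) := by abel
    _ = 0 := by rw [hx.2, sub_self]

theorem two_mul_card_le_sumEdges (hO : OddCoset O) {s : G} (hs : s ∉ O) :
    O.card ≤ 2 * (sumEdges O s).card + (O.filter fun x => x + x = s).card +
      2 * (O.filter fun x => x + x = 0).card := by
  have h1 := card_filter_le_two_mul_sumEdges (O := O) s
  have h2 := card_odd_le (O := O) s
  have h3 := card_filter_add_self_eq_add_self_le hO hs
  have h4 : (O.filter fun x => x + x = 0 ∨ x + x = s + s).card ≤
      (O.filter fun x => x + x = 0).card + (O.filter fun x => x + x = s + s).card := by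
    rw [Finset.filter_or]; exact Finset.card_union_le _ _
  omega

theorem card_schurEdges_of_add_self_eq_zero {s : G} (h0 : s + s = 0) :
    2 * O.card ≤ 2 * (schurEdges O s).card + (O.filter fun x => x + x = s).card +
      (O.filter fun x => x + x = 0).card := by
  have h1 := card_filter_le_two_mul_sumEdges (O := O) s
  have h2 := card_odd_le (O := O) s
  have h4 := card_le_two_mul_diffEdges (O := O) s
  rw [card_schurEdges]
  simp only [h0, or_self] at h1 h2
  omega

theorem card_schurEdges_of_add_self_ne_zero (hO : OddCoset O) {s : G} (hs : s ∉ O)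
    (h0 : s + s ≠ 0) :
    3 * O.card ≤ 2 * (schurEdges O s).card + (O.filter fun x => x + x = s).card +
      2 * (O.filter fun x => x + x = 0).card := by
  have h1 := two_mul_card_le_sumEdges hO hs
  have h4 := card_diffEdges (O := O) h0
  rw [card_schurEdges]
  omega

theorem sum_of_mem_sumEdges {s : G} {e : Finset G} (he : e ∈ sumEdges O s) : ∑ x ∈ e, x = s := by
  obtain ⟨x, -, h1, -, -, rfl⟩ := mem_sumEdges he
  rw [Finset.sum_pair fun h => h1 (by rw [eq_sub_iff_add_eq] at h; exact h)]
  abel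

/-- The endpoint sum of an edge determines `s` modulo `2G`, so distinct cosets of `2G` have disjoint
edge sets. -/
theorem sum_of_mem_schurEdges {s : G} (hs0 : s ≠ 0) {e : Finset G} (he : e ∈ schurEdges O s) :
    ∃ g, ∑ x ∈ e, x = s + (g + g) := by
  rcases Finset.mem_union.1 he with he | he
  · exact ⟨0, by rw [sum_of_mem_sumEdges he]; simp⟩
  · obtain ⟨x, -, rfl⟩ := mem_diffEdges he
    refine ⟨x, ?_⟩
    rw [Finset.sum_pair fun h => hs0 (by simpa using h)]
    abel

theorem disjoint_sumEdges {s t : G} (hst : s ≠ t) : Disjoint (sumEdges O s) (sumEdges O t) := by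
  rw [Finset.disjoint_left]
  exact fun e he he' => hst ((sum_of_mem_sumEdges he).symm.trans (sum_of_mem_sumEdges he'))

theorem disjoint_schurEdges {s t : G} (hs : s ≠ 0) (ht : t ≠ 0) (hst : ∀ g, s - t ≠ g + g) :
    Disjoint (schurEdges O s) (schurEdges O t) := by
  rw [Finset.disjoint_left]
  intro e he he'
  obtain ⟨g, hg⟩ := sum_of_mem_schurEdges hs he
  obtain ⟨g', hg'⟩ := sum_of_mem_schurEdges ht he'
  apply hst (g' - g)
  have : s + (g + g) = t + (g' + g') := hg.symm.trans hg'
  rw [sub_eq_iff_eq_add]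
  calc s = s + (g + g) - (g + g) := by abel
    _ = _ := by rw [this]; abel

theorem disjoint_diffEdges {s t : G} (hst : s ≠ t) (hst' : s ≠ -t) :
    Disjoint (diffEdges O s) (diffEdges O t) := by
  rw [Finset.disjoint_left]
  intro e he he'
  obtain ⟨x, -, rfl⟩ := mem_diffEdges he
  obtain ⟨y, -, hy⟩ := mem_diffEdges he'
  rcases pair_eq_pair hy with ⟨rfl, h⟩ | ⟨rfl, h⟩
  · exact hst (add_left_cancel h)
  · rw [add_assoc, add_eq_left] at h
    exact hst' (eq_neg_of_add_eq_zero_right h)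

variable [Fintype G]

theorem card_filter_add_self_eq_le (s : G) :
    (Finset.univ.filter fun x : G => x + x = s).card ≤
      (Finset.univ.filter fun x : G => x + x = 0).card := by
  rcases (Finset.univ.filter fun x : G => x + x = s).eq_empty_or_nonempty with h | ⟨y, hy⟩
  · rw [h]; simp
  · refine Finset.card_le_card_of_injOn (fun x => x - y) (fun x hx => ?_)
      (fun x _ y _ h => sub_left_injective h)
    simp only [Finset.coe_filter, Finset.mem_filter, Finset.mem_univ, true_and,
      Set.mem_ofPred_eq] at hx hy ⊢
    calc x - y + (x - y) = x + x - (y + y) := by abel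
      _ = 0 := by rw [hx, hy, sub_self]

theorem r_eq_card : r G = (Finset.univ.filter fun x : G => x + x = 0).card := by
  rw [r, Nat.card_eq_fintype_card, Fintype.card_subtype]
  congr 1
  ext x
  simp [eq_neg_iff_add_eq_zero]

theorem card_odd_filter_add_self_eq_le (O : Finset G) (s : G) :
    (O.filter fun x => x + x = s).card ≤ r G := by
  rw [r_eq_card]
  exact (Finset.card_le_card (Finset.filter_subset_filter _ (Finset.subset_univ _))).trans
    (card_filter_add_self_eq_le s)

/-- Translation by one odd solution of `2x = 0` injects the odd solutions into the even ones. This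
factor two is what produces `4 - β` in the dense case. -/
theorem two_mul_card_odd_filter_le (hO : OddCoset O) :
    2 * (O.filter fun x => x + x = 0).card ≤ r G := by
  rcases (O.filter fun x => x + x = 0).eq_empty_or_nonempty with h | ⟨y, hy⟩
  · rw [h]; simp
  rw [Finset.mem_filter] at hy
  have hle : (O.filter fun x => x + x = 0).card ≤ (Oᶜ.filter fun x => x + x = 0).card := by
    refine Finset.card_le_card_of_injOn (fun x => x + y) (fun x hx => ?_)
      (fun x _ y _ h => add_right_cancel h)
    simp only [Finset.coe_filter, Finset.mem_compl, Set.mem_ofPred_eq] at hx ⊢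
    refine ⟨fun h => ?_, ?_⟩
    · rw [hO] at h; simp [hx.1, hy.1] at h
    · calc x + y + (x + y) = (x + x) + (y + y) := by abel
        _ = 0 := by rw [hx.2, hy.2, add_zero]
  rw [r_eq_card, ← Finset.union_compl O, Finset.filter_union, Finset.card_union_of_disjoint]
  · omega
  · exact Finset.disjoint_filter_filter (disjoint_compl_right)

/-- Two sum edges cannot coincide, nor can two difference edges. A sum edge for `a` that is a
difference edge `{x, x + b}` for `b` forces `2x = a - b`, which has at most `r G` solutions. -/
theorem card_inter_schurEdges_le {s t : G} (hst : s ≠ t) (hst' : s ≠ -t) :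
    (schurEdges O s ∩ schurEdges O t).card ≤ 2 * r G := by
  have key : ∀ a b : G, ((sumEdges O a) ∩ (diffEdges O b)).card ≤ r G := fun a b => by
    refine le_trans ?_ (card_odd_filter_add_self_eq_le O (a - b))
    refine (Finset.card_le_card (t := (O.filter fun x => x + x = a - b).image
      fun x => {x, x + b}) fun e he => ?_).trans Finset.card_image_le
    rw [Finset.mem_inter] at he
    have hsum := sum_of_mem_sumEdges he.1
    have h2 : e.card = 2 := by
      obtain ⟨x, -, h1, -, -, rfl⟩ := mem_sumEdges he.1
      exact Finset.card_pair fun h => h1 (by rw [eq_sub_iff_add_eq] at h; exact h)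
    obtain ⟨x, hx, rfl⟩ := mem_diffEdges he.2
    have hne : x ≠ x + b := fun h => by rw [← h] at h2; simp at h2
    rw [Finset.sum_pair hne] at hsum
    refine Finset.mem_image.2 ⟨x, Finset.mem_filter.2 ⟨hx, ?_⟩, rfl⟩
    rw [← hsum]; abel
  have hsub : schurEdges O s ∩ schurEdges O t ⊆
      (sumEdges O s ∩ diffEdges O t) ∪ (sumEdges O t ∩ diffEdges O s) := by
    intro e he
    rw [Finset.mem_inter] at he
    rcases Finset.mem_union.1 he.1 with h1 | h1 <;> rcases Finset.mem_union.1 he.2 with h2 | h2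
    · exact absurd h2 (Finset.disjoint_left.1 (disjoint_sumEdges hst) h1)
    · simp [h1, h2]
    · simp [h1, h2]
    · exact absurd h2 (Finset.disjoint_left.1 (disjoint_diffEdges hst hst') h1)
  refine (Finset.card_le_card hsub).trans ((Finset.card_union_le _ _).trans ?_)
  have := key s t
  have := key t s
  omega

/-- Bonferroni: the overcount is at most the total of the pairwise intersections. -/
theorem sum_card_le_card_schurGraph {w : ℕ} (S : Finset G)
    (h : ∀ s ∈ S, ∀ t ∈ S, s ≠ t → (schurEdges O s ∩ schurEdges O t).card ≤ w) :
    ∑ s ∈ S, (schurEdges O s).card ≤ (schurGraph O S).card + w * S.card ^ 2 := by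
  induction S using Finset.induction_on with
  | empty => simp
  | insert a S ha ih =>
    have ih' := ih fun s hs t ht => h s (Finset.mem_insert_of_mem hs) t (Finset.mem_insert_of_mem ht)
    rw [Finset.sum_insert ha, Finset.card_insert_of_notMem ha, schurGraph, Finset.biUnion_insert]
    have h1 := Finset.card_union_add_card_inter (schurEdges O a) (schurGraph O S)
    have h2 : (schurEdges O a ∩ schurGraph O S).card ≤ S.card * w := by
      rw [schurGraph, Finset.inter_biUnion]
      exact Finset.card_biUnion_le_card_mul _ _ _ fun s hs =>
        h a (Finset.mem_insert_self a S) s (Finset.mem_insert_of_mem hs) fun e => ha (e ▸ hs)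
    rw [schurGraph] at h1 h2 ih'
    nlinarith

theorem card_range_two_mul_r : Nat.card (nsmulAddMonoidHom 2 : G →+ G).range * r G =
    Fintype.card G := by
  have h1 : r G = Nat.card (nsmulAddMonoidHom 2 : G →+ G).ker := by
    rw [r]
    refine Nat.card_congr (Equiv.subtypeEquivRight fun x => ?_)
    rw [AddMonoidHom.mem_ker, nsmulAddMonoidHom_apply, two_nsmul, eq_neg_iff_add_eq_zero]
  rw [h1, ← Nat.card_eq_fintype_card, ← AddSubgroup.card_mul_index (nsmulAddMonoidHom 2 : G →+ G).ker,
    AddSubgroup.index_ker, mul_comm]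

/-- An edge of `A` missed by `T` would survive together with its element of `S`, giving a Schur
triple. Zero is excluded from `S` because `0 + 0 = 0`. -/
theorem EventB.cover (hO : OddCoset O) {k : ℕ} {A : Finset G} (h : EventB O k A) :
    ∃ S ∈ (Oᶜ.erase 0).powersetCard k, S ⊆ A ∧ ∃ T : Finset G, T.card ≤ k ∧
      ∀ e ∈ schurGraph O S, e ⊆ A → ¬ Disjoint e T := by
  obtain ⟨S, T, hS, hT, hSk, hTk, hsf⟩ := h
  have hSO : ∀ s ∈ S, s ∈ A ∧ s ∉ O := fun s hs => by simpa using hS hs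
  have hTO : ∀ t ∈ T, t ∈ O := fun t ht => (Finset.mem_inter.1 (hT ht)).2
  have hSm : ∀ s ∈ S, s ∈ ((A ∩ O) ∪ S) \ T := fun s hs => by
    simp only [Finset.mem_sdiff, Finset.mem_union, hs, or_true, true_and]
    exact fun h => (hSO s hs).2 (hTO s h)
  have h0 : (0 : G) ∉ S := fun h => by
    have := hsf 0 (hSm 0 h) 0 (hSm 0 h)
    rw [add_zero] at this
    exact this (hSm 0 h)
  refine ⟨S, Finset.mem_powersetCard.2 ⟨fun s hs => Finset.mem_erase.2
    ⟨fun e => h0 (e ▸ hs), Finset.mem_compl.2 (hSO s hs).2⟩, hSk⟩, fun s hs => (hSO s hs).1, T, hTk,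
    fun e he heA hd => ?_⟩
  obtain ⟨s, hs, he⟩ := Finset.mem_biUnion.1 he
  have heO := schurEdges_subset hO (hSO s hs).2 he
  have hm : ∀ x ∈ e, x ∈ ((A ∩ O) ∪ S) \ T := fun x hx => by
    simp only [Finset.mem_sdiff, Finset.mem_union, Finset.mem_inter]
    exact ⟨Or.inl ⟨heA hx, heO hx⟩, Finset.disjoint_left.1 hd hx⟩
  rcases Finset.mem_union.1 he with he | he
  · obtain ⟨x, -, -, -, -, rfl⟩ := mem_sumEdges he
    have := hsf x (hm x (by simp)) (s - x) (hm _ (by simp))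
    rw [add_sub_cancel] at this
    exact this (hSm s hs)
  · obtain ⟨x, -, rfl⟩ := mem_diffEdges he
    exact hsf x (hm x (by simp)) s (hSm s hs) (hm _ (by simp))

end Graph

/-! ### Summation over matchings and over transversals -/

section Sums

/-- Bounds the sum over matchings of size at most `k`. Since `z ≥ 1`, each `z ^ i` is at most `z ^
k`, and the remaining series is dominated by that of `exp k`. -/
theorem sum_pow_div_factorial_le {x z : ℝ} {k : ℕ} (hx : 0 ≤ x) (hz : 1 ≤ z) (hxz : x ≤ k * z) :
    ∑ i ∈ Finset.range (k + 1), x ^ i / (i.factorial : ℝ) ≤ (Real.exp 1 * z) ^ k := by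
  have hz0 : 0 ≤ z := by linarith
  calc ∑ i ∈ Finset.range (k + 1), x ^ i / (i.factorial : ℝ)
      ≤ ∑ i ∈ Finset.range (k + 1), z ^ k * ((k : ℝ) ^ i / (i.factorial : ℝ)) := by
        refine Finset.sum_le_sum fun i hi => ?_
        rw [← mul_div_assoc]
        refine div_le_div_of_nonneg_right ?_ (by positivity)
        calc x ^ i ≤ (k * z) ^ i := pow_le_pow_left₀ hx hxz i
          _ = z ^ i * (k : ℝ) ^ i := by rw [mul_pow, mul_comm]
          _ ≤ z ^ k * (k : ℝ) ^ i := by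
            refine mul_le_mul_of_nonneg_right ?_ (by positivity)
            exact pow_le_pow_right₀ hz (by rw [Finset.mem_range] at hi; omega)
    _ ≤ z ^ k * Real.exp k := by
        rw [← Finset.mul_sum]
        exact mul_le_mul_of_nonneg_left (Real.sum_le_exp_of_nonneg (by positivity) _)
          (by positivity)
    _ = _ := by rw [mul_pow, ← Real.exp_nat_mul, mul_one, mul_comm]

theorem choose_mul_pow_le {N k : ℕ} {a x : ℝ} (ha : 0 ≤ a) (h : N * a ≤ x) :
    (N.choose k : ℝ) * a ^ k ≤ x ^ k / (k.factorial : ℝ) := by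
  calc (N.choose k : ℝ) * a ^ k ≤ (N : ℝ) ^ k / (k.factorial : ℝ) * a ^ k :=
        mul_le_mul_of_nonneg_right (Nat.choose_le_pow_div k N) (by positivity)
    _ = (N * a) ^ k / (k.factorial : ℝ) := by rw [mul_pow]; ring
    _ ≤ _ := by gcongr

theorem pow_div_factorial_le_pow (x : ℝ) (hx : 0 ≤ x) (k : ℕ) (hk : 1 ≤ k) :
    x ^ k / (k.factorial : ℝ) ≤ (Real.exp 1 * (x / k)) ^ k := by
  have hk' : (0 : ℝ) < k := by exact_mod_cast hk
  have h1 : (k : ℝ) ^ k / (k.factorial : ℝ) ≤ Real.exp k :=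
    Real.pow_div_factorial_le_exp k hk'.le k
  calc x ^ k / (k.factorial : ℝ) = (x / k) ^ k * ((k : ℝ) ^ k / (k.factorial : ℝ)) := by
        rw [div_pow]; field_simp
    _ ≤ (x / k) ^ k * Real.exp k := mul_le_mul_of_nonneg_left h1 (by positivity)
    _ = _ := by rw [mul_pow, ← Real.exp_nat_mul, mul_one, mul_comm]

/-- An elementary symmetric polynomial is at most the corresponding power of the sum. -/
theorem sum_powersetCard_prod_le {ι : Type*} [DecidableEq ι] (U : Finset ι) {f : ι → ℝ}
    (hf : ∀ i, 0 ≤ f i) (j : ℕ) :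
    ∑ S ∈ U.powersetCard j, ∏ s ∈ S, f s ≤ (∑ s ∈ U, f s) ^ j := by
  induction U using Finset.induction_on generalizing j with
  | empty =>
    cases j with
    | zero => simp
    | succ j =>
      rw [Finset.powersetCard_eq_empty.2 (by simp)]
      simp
  | insert a U ha ih =>
    cases j with
    | zero => simp
    | succ j =>
      have hU : 0 ≤ ∑ s ∈ U, f s := Finset.sum_nonneg fun i _ => hf i
      rw [Finset.powersetCard_succ_insert ha, Finset.sum_union, Finset.sum_image,
        Finset.sum_insert ha]
      · have h1 : ∑ S ∈ U.powersetCard j, ∏ s ∈ insert a S, f s ≤ f a * (∑ s ∈ U, f s) ^ j := by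
          rw [Finset.sum_congr rfl (g := fun S => f a * ∏ s ∈ S, f s) fun S hS =>
            Finset.prod_insert fun h => ha ((Finset.mem_powersetCard.1 hS).1 h), ← Finset.mul_sum]
          exact mul_le_mul_of_nonneg_left (ih j) (hf a)
        have h2 : (∑ s ∈ U, f s) ^ j ≤ (f a + ∑ s ∈ U, f s) ^ j :=
          pow_le_pow_left₀ hU (by linarith [hf a]) j
        have h3 := ih (j + 1)
        calc _ ≤ (∑ s ∈ U, f s) ^ (j + 1) + f a * (∑ s ∈ U, f s) ^ j := add_le_add h3 h1
          _ = (f a + ∑ s ∈ U, f s) * (∑ s ∈ U, f s) ^ j := by ring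
          _ ≤ (f a + ∑ s ∈ U, f s) * (f a + ∑ s ∈ U, f s) ^ j :=
            mul_le_mul_of_nonneg_left h2 (by linarith [hf a])
          _ = _ := by ring
      · intro S hS T hT hST
        have hS' : a ∉ S := fun h => ha ((Finset.mem_powersetCard.1 hS).1 h)
        have hT' : a ∉ T := fun h => ha ((Finset.mem_powersetCard.1 hT).1 h)
        rw [← Finset.erase_insert hS', ← Finset.erase_insert hT']
        exact congrArg (fun X : Finset ι => X.erase a) hST
      · rw [Finset.disjoint_left]
        intro S hS hS'
        obtain ⟨T, -, rfl⟩ := Finset.mem_image.1 hS'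
        exact ha ((Finset.mem_powersetCard.1 hS).1 (Finset.mem_insert_self a T))

theorem exists_transversal {ι κ : Type*} (cl : ι → κ) (S : Finset ι) :
    ∃ S' ⊆ S, Set.InjOn cl S' ∧ ∀ s ∈ S, ∃ t ∈ S', cl s = cl t := by
  classical
  obtain ⟨S', h1, h3, h2⟩ := Finset.exists_subset_injOn_image_eq_of_surjOn S (S.image cl)
    (f := cl) (by rw [Finset.coe_image]; exact Set.surjOn_image cl _)
  refine ⟨S', h1, h3, fun s hs => ?_⟩
  have := Finset.mem_image_of_mem cl hs
  rw [← h2] at this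
  obtain ⟨t, ht, e⟩ := Finset.mem_image.1 this
  exact ⟨t, ht, e.symm⟩

/-- Each `S` is encoded by a transversal `S'` of size `j` together with its other `k - j` elements.
Those lie in the classes of `S'`, hence among at most `j * D` elements, which gives the binomial
factor. -/
theorem sum_le_of_transversal {ι κ : Type*} [Fintype ι] [DecidableEq ι] [DecidableEq κ]
    (cl : ι → κ) {D : ℕ}
    (hD : ∀ s, (Finset.univ.filter fun t => cl t = cl s).card ≤ D) (U : Finset ι) (k : ℕ)
    {F : Finset ι → ℝ} {f : ι → ℝ} {B : ℝ} (hB : 0 ≤ B) (hf : ∀ i, 0 ≤ f i)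
    (hF : ∀ S ∈ U.powersetCard k, ∀ S' ⊆ S, Set.InjOn cl S' → F S ≤ B * ∏ s ∈ S', f s) :
    ∑ S ∈ U.powersetCard k, F S ≤
      B * ∑ j ∈ Finset.range (k + 1), (∑ s ∈ U, f s) ^ j * ((j * D).choose (k - j) : ℝ) := by
  set N : Finset ι → Finset ι := fun S' =>
    S'.biUnion fun s => Finset.univ.filter fun t => cl t = cl s with hN
  have hNc : ∀ S', (N S').card ≤ S'.card * D := fun S' =>
    Finset.card_biUnion_le_card_mul _ _ _ fun s _ => hD s
  have hnn : ∀ S' : Finset ι, 0 ≤ B * ∏ s ∈ S', f s := fun S' =>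
    mul_nonneg hB (Finset.prod_nonneg fun s _ => hf s)
  have step1 : ∀ S ∈ U.powersetCard k, F S ≤ ∑ j ∈ Finset.range (k + 1),
      ∑ S' ∈ U.powersetCard j,
        ind (S' ⊆ S ∧ S \ S' ∈ (N S').powersetCard (k - j)) * (B * ∏ s ∈ S', f s) := by
    intro S hS
    obtain ⟨S', hS', hinj, htr⟩ := exists_transversal cl S
    obtain ⟨hSU, hSk⟩ := Finset.mem_powersetCard.1 hS
    have hle := Finset.card_le_card hS'
    refine (hF S hS S' hS' hinj).trans ?_
    have hterm : ∀ j, ∀ S' ∈ U.powersetCard j,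
        0 ≤ ind (S' ⊆ S ∧ S \ S' ∈ (N S').powersetCard (k - j)) * (B * ∏ s ∈ S', f s) :=
      fun j S' _ => mul_nonneg (ind_nonneg _) (hnn S')
    have hj : S'.card ∈ Finset.range (k + 1) := Finset.mem_range.2 (by omega)
    refine le_trans ?_ (Finset.single_le_sum (fun j _ => Finset.sum_nonneg (hterm j)) hj)
    refine le_trans ?_ (Finset.single_le_sum (hterm S'.card)
      (Finset.mem_powersetCard.2 ⟨hS'.trans hSU, rfl⟩))
    rw [ind_of, one_mul]
    refine ⟨hS', Finset.mem_powersetCard.2 ⟨fun t ht => ?_, ?_⟩⟩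
    · obtain ⟨s, hs, e⟩ := htr t (Finset.mem_sdiff.1 ht).1
      exact Finset.mem_biUnion.2 ⟨s, hs, by simp [e]⟩
    · rw [Finset.card_sdiff_of_subset hS', hSk]
  refine (Finset.sum_le_sum step1).trans ?_
  rw [Finset.sum_comm, Finset.mul_sum]
  refine Finset.sum_le_sum fun j _ => ?_
  rw [Finset.sum_comm]
  calc _ ≤ ∑ S' ∈ U.powersetCard j, ((j * D).choose (k - j) : ℝ) * (B * ∏ s ∈ S', f s) := by
        refine Finset.sum_le_sum fun S' hS' => ?_
        rw [← Finset.sum_mul]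
        refine mul_le_mul_of_nonneg_right ?_ (hnn S')
        have h1 : ∑ S ∈ U.powersetCard k, ind (S' ⊆ S ∧ S \ S' ∈ (N S').powersetCard (k - j)) =
            (((U.powersetCard k).filter fun S =>
              S' ⊆ S ∧ S \ S' ∈ (N S').powersetCard (k - j)).card : ℝ) := by
          rw [Finset.card_filter]
          push_cast
          refine Finset.sum_congr rfl fun S _ => ?_
          unfold ind
          congr
        rw [h1]
        have h2 : ((U.powersetCard k).filter fun S =>
            S' ⊆ S ∧ S \ S' ∈ (N S').powersetCard (k - j)).card ≤
            ((N S').powersetCard (k - j)).card := by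
          refine Finset.card_le_card_of_injOn (fun S => S \ S') (fun S hS => ?_) ?_
          · exact (Finset.mem_filter.1 hS).2.2
          · intro S hS T hT hST
            have h3 := (Finset.mem_filter.1 hS).2.1
            have h4 := (Finset.mem_filter.1 hT).2.1
            rw [← Finset.sdiff_union_of_subset h3, ← Finset.sdiff_union_of_subset h4]
            exact congrArg (fun X => X ∪ S') hST
        rw [Finset.card_powersetCard] at h2
        have h5 : (N S').card ≤ j * D := by
          have := hNc S'
          rwa [(Finset.mem_powersetCard.1 hS').2] at this
        exact_mod_cast h2.trans (Nat.choose_le_choose _ h5)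
    _ = B * ((∑ S' ∈ U.powersetCard j, ∏ s ∈ S', f s) * ((j * D).choose (k - j) : ℝ)) := by
        rw [Finset.sum_mul, Finset.mul_sum]
        exact Finset.sum_congr rfl fun S' _ => by ring
    _ ≤ _ := by
        refine mul_le_mul_of_nonneg_left ?_ hB
        exact mul_le_mul_of_nonneg_right (sum_powersetCard_prod_le U hf j) (Nat.cast_nonneg _)

/-- Each transversal element costs `b * Z ≤ ζ`; the others cost `(ζ j)^(k-j) / (k-j)!`, at most
`ζ^(k-j) * exp j`. The factor 2 absorbs the `k + 1 ≤ 2 ^ k` values of `j`. -/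
theorem sum_pow_mul_choose_le {k D : ℕ} {b Z ζ : ℝ} (hb : 0 ≤ b) (hZ0 : 0 ≤ Z)
    (hZ : b * Z ≤ ζ) (hDb : D * b ≤ ζ) :
    b ^ k * ∑ j ∈ Finset.range (k + 1), Z ^ j * ((j * D).choose (k - j) : ℝ) ≤
      (2 * Real.exp 1 * ζ) ^ k := by
  have hζ : 0 ≤ ζ := (mul_nonneg hb hZ0).trans hZ
  rw [Finset.mul_sum]
  have hterm : ∀ j ∈ Finset.range (k + 1),
      b ^ k * (Z ^ j * ((j * D).choose (k - j) : ℝ)) ≤ (Real.exp 1 * ζ) ^ k := by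
    intro j hj
    have hjk : j ≤ k := by rw [Finset.mem_range] at hj; omega
    have h1 : ((j * D).choose (k - j) : ℝ) * b ^ (k - j) ≤ ζ ^ (k - j) * Real.exp j := by
      refine (choose_mul_pow_le hb (x := ζ * j) ?_).trans ?_
      · push_cast
        nlinarith [(Nat.cast_nonneg j : (0 : ℝ) ≤ j)]
      · rw [mul_pow, mul_div_assoc]
        exact mul_le_mul_of_nonneg_left
          (Real.pow_div_factorial_le_exp _ (Nat.cast_nonneg _) _) (by positivity)
    calc b ^ k * (Z ^ j * ((j * D).choose (k - j) : ℝ))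
        = (b * Z) ^ j * (((j * D).choose (k - j) : ℝ) * b ^ (k - j)) := by
          conv_lhs => rw [← Nat.add_sub_cancel' hjk, pow_add]
          rw [Nat.add_sub_cancel' hjk, mul_pow]; ring
      _ ≤ ζ ^ j * (ζ ^ (k - j) * Real.exp j) := by
          refine mul_le_mul (pow_le_pow_left₀ (mul_nonneg hb hZ0) hZ j) h1 (by positivity)
            (by positivity)
      _ = ζ ^ k * Real.exp j := by rw [← mul_assoc, ← pow_add, Nat.add_sub_cancel' hjk]
      _ ≤ ζ ^ k * Real.exp k := by
          refine mul_le_mul_of_nonneg_left (Real.exp_le_exp.2 ?_) (by positivity)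
          exact_mod_cast hjk
      _ = _ := by rw [mul_pow, ← Real.exp_nat_mul, mul_one, mul_comm]
  refine (Finset.sum_le_sum hterm).trans ?_
  rw [Finset.sum_const, Finset.card_range, nsmul_eq_mul, mul_assoc 2, mul_pow 2]
  refine mul_le_mul_of_nonneg_right ?_ (by positivity)
  exact_mod_cast Nat.lt_two_pow_self

end Sums

/-! ### The union bound for small and for large `k` -/

section Regimes

variable {G : Type*} [AddCommGroup G] [Fintype G] [DecidableEq G]

theorem schurGraph_mono (O : Finset G) {S S' : Finset G} (h : S' ⊆ S) :
    schurGraph O S' ⊆ schurGraph O S :=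
  Finset.biUnion_subset_biUnion_of_subset_left _ h

theorem randomSubsetProb_eventB_le {O : Finset G} (hO : OddCoset O) {q : G → ℝ}
    (h0 : ∀ x, 0 ≤ q x) (h1 : ∀ x, q x ≤ 1) (k : ℕ) :
    randomSubsetProb q (EventB O k) ≤ ∑ S ∈ (Oᶜ.erase 0).powersetCard k,
      ev q (fun A => ind (S ⊆ A ∧ ∃ T : Finset G, T.card ≤ k ∧
        ∀ e ∈ schurGraph O S, e ⊆ A → ¬ Disjoint e T)) := by
  rw [randomSubsetProb_eq_ev, ← ev_sum]
  refine ev_mono h0 h1 fun A => ?_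
  by_cases h : EventB O k A
  · obtain ⟨S, hS, hSA⟩ := h.cover hO
    rw [ind_of h]
    refine le_trans ?_ (Finset.single_le_sum (fun S _ => ind_nonneg _) hS)
    rw [ind_of hSA]
  · rw [ind_not h]
    exact Finset.sum_nonneg fun S _ => ind_nonneg _

/-- Passing to a subset `S'` of `S` discards cover constraints but still requires `S ⊆ A`, so the
whole factor `b ^ k` is kept. The density `c` may lie below the true one, to meet the degree
condition of Janson. -/
theorem ev_schurGraph_cover_le {O : Finset G} (hO : OddCoset O) {q : G → ℝ} {a b p c m z : ℝ}
    (hc : 0 ≤ c) (hca : c ≤ a) (hap : a ≤ p) (hab : a ≤ b) (hb : b ≤ 1)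
    (hqO : ∀ x ∈ O, q x = a) (hqE : ∀ x ∉ O, q x = b) {k : ℕ} {S S' : Finset G}
    (hS : S ∈ (Oᶜ.erase 0).powersetCard k) (hS' : S' ⊆ S) (hm : m ≤ (schurGraph O S').card)
    (hc1 : 6 * S'.card * c ≤ 1) (hz : 1 ≤ z) (hkz : 2 * O.card * S'.card * p ^ 2 ≤ k * z) :
    ev q (fun A => ind (S ⊆ A ∧ ∃ T : Finset G, T.card ≤ k ∧
        ∀ e ∈ schurGraph O S, e ⊆ A → ¬ Disjoint e T)) ≤
      b ^ k * ((Real.exp 1 * z) ^ k *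
        Real.exp (-((m - 6 * k * S'.card) * (c ^ 2 * (1 - 6 * S'.card * c))))) := by
  have ha : 0 ≤ a := hc.trans hca
  have hp : 0 ≤ p := ha.trans hap
  obtain ⟨hSU, hSk⟩ := Finset.mem_powersetCard.1 hS
  have hU : ∀ s ∈ S, s ≠ 0 ∧ s ∉ O := fun s hs => by simpa using hSU hs
  have hq0 : ∀ x, 0 ≤ q x := fun x => by
    by_cases hx : x ∈ O
    · rw [hqO x hx]; exact ha
    · rw [hqE x hx]; exact ha.trans hab
  have hq1 : ∀ x, q x ≤ 1 := fun x => by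
    by_cases hx : x ∈ O
    · rw [hqO x hx]; exact hab.trans hb
    · rw [hqE x hx]; exact hb
  have h1 : ev q (fun A => ind (S ⊆ A ∧ ∃ T : Finset G, T.card ≤ k ∧
        ∀ e ∈ schurGraph O S, e ⊆ A → ¬ Disjoint e T)) ≤
      ev q (fun A => ind (S ⊆ A ∧ ∃ T : Finset G, T.card ≤ k ∧
        ∀ e ∈ schurGraph O S', e ⊆ A → ¬ Disjoint e T)) :=
    ev_mono hq0 hq1 fun A => ind_mono fun ⟨hSA, T, hT, H⟩ =>
      ⟨hSA, T, hT, fun e he => H e (schurGraph_mono O hS' he)⟩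
  refine h1.trans ((ev_cover_le (O := O) (d := 3 * S'.card) hc hca hab hb hqO hqE
    (fun s hs => Finset.mem_compl.2 (hU s hs).2) hSk (schurGraph O S') ?_ ?_
    (schurGraph_degree_le S') (by push_cast; linarith)).trans ?_)
  · intro e he
    obtain ⟨s, hs, he⟩ := Finset.mem_biUnion.1 he
    exact schurEdges_card_eq (hU s (hS' hs)).1 he
  · intro e he
    obtain ⟨s, hs, he⟩ := Finset.mem_biUnion.1 he
    exact schurEdges_subset hO (hU s (hS' hs)).2 he
  refine mul_le_mul_of_nonneg_left (mul_le_mul ?_ ?_ (Real.exp_pos _).le (by positivity))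
    (pow_nonneg (ha.trans hab) _)
  · refine le_trans (Finset.sum_le_sum fun i _ => ?_)
      (sum_pow_div_factorial_le (x := 2 * O.card * S'.card * p ^ 2) (by positivity) hz hkz)
    rw [pow_mul]
    refine choose_mul_pow_le (by positivity) ?_
    have h2 : ((schurGraph O S').card : ℝ) ≤ 2 * O.card * S'.card := by
      exact_mod_cast card_schurGraph_le S'
    exact mul_le_mul h2 (pow_le_pow_left₀ ha hap 2) (by positivity) (by positivity)
  · rw [Real.exp_le_exp, neg_le_neg_iff]
    push_cast
    have h3 : 0 ≤ c ^ 2 * (1 - 6 * S'.card * c) := mul_nonneg (by positivity) (by linarith)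
    calc (m - 6 * k * S'.card) * (c ^ 2 * (1 - 6 * S'.card * c))
        ≤ ((schurGraph O S').card - 6 * k * S'.card) * (c ^ 2 * (1 - 6 * S'.card * c)) :=
          mul_le_mul_of_nonneg_right (by linarith) h3
      _ = _ := by ring

theorem biasedProb_bounds (O : Finset G) {δ p : ℝ} (hδ0 : 0 ≤ δ) (hδ1 : δ ≤ 1) (hp : 0 ≤ p)
    (hp1 : (1 + δ) * p ≤ 1) :
    (∀ x, 0 ≤ biasedProb O δ p x) ∧ (∀ x, biasedProb O δ p x ≤ 1) ∧
    (∀ x ∈ O, biasedProb O δ p x = (1 - δ) * p) ∧ ∀ x ∉ O, biasedProb O δ p x = (1 + δ) * p := by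
  refine ⟨fun x => ?_, fun x => ?_, fun x hx => by simp [biasedProb, hx],
    fun x hx => by simp [biasedProb, hx]⟩ <;> unfold biasedProb <;> split_ifs <;> nlinarith

/-- A convex combination of two exponents is at most the larger. This combines the sharp bound over
`S'` with the crude bound over `S`. -/
theorem le_mul_exp_interpolate {v a x y τ : ℝ} (ha : 0 ≤ a) (hτ0 : 0 ≤ τ) (hτ1 : τ ≤ 1)
    (hx : v ≤ a * Real.exp (-x)) (hy : v ≤ a * Real.exp (-y)) :
    v ≤ a * Real.exp (-((1 - τ) * x + τ * y)) := by
  rcases le_total x y with h | h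
  · refine hy.trans (mul_le_mul_of_nonneg_left (Real.exp_le_exp.2 ?_) ha)
    nlinarith
  · refine hx.trans (mul_le_mul_of_nonneg_left (Real.exp_le_exp.2 ?_) ha)
    nlinarith

theorem edge_factor_le {δ p c k j : ℝ} (hδ0 : 0 ≤ δ) (hp : 0 ≤ p)
    (hc : 6 * k * p ≤ c) (hj0 : 0 ≤ j) (hjk : j ≤ k) :
    (1 - δ) ^ 2 * p ^ 2 * (1 - c) ≤ ((1 - δ) * p) ^ 2 * (1 - 6 * j * ((1 - δ) * p)) := by
  rw [mul_pow]
  refine mul_le_mul_of_nonneg_left ?_ (by positivity)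
  have h1 : j * p ≤ k * p := mul_le_mul_of_nonneg_right hjk hp
  have h2 : 0 ≤ δ * (j * p) := by positivity
  have h3 : 6 * j * ((1 - δ) * p) = 6 * (j * p) - 6 * (δ * (j * p)) := by ring
  linarith

/-- The term `6 k j`, edges lost to the matching, is at most `12 δ n W` because `k ≤ δ n` and `j ≤ 2
W`. All multiplicative losses are collected in `g`. -/
theorem sharp_exponent_le {n : ℕ} {δ p c η τ g k j W : ℝ} (hδ0 : 0 ≤ δ)
    (hp : 0 ≤ p) (hkn : k ≤ δ * n) (hc : 6 * k * p ≤ c) (hc1 : c ≤ 1)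
    (hη1 : η + 12 * δ ≤ 1) (hτ1 : τ ≤ 1)
    (hg : 1 - g ≤ (1 - δ) ^ 2 * (1 - η - 12 * δ) * (1 - c) * (1 - τ))
    (hj0 : 0 ≤ j) (hjk : j ≤ k) (hWj : j / 2 ≤ W) :
    n * p ^ 2 * (1 - g) * W ≤ (1 - τ) * ((n * ((1 - η) * W) - 6 * k * j) *
      (((1 - δ) * p) ^ 2 * (1 - 6 * j * ((1 - δ) * p)))) := by
  have hn0 : (0 : ℝ) ≤ n := Nat.cast_nonneg n
  have hW0 : 0 ≤ W := le_trans (by positivity) hWj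
  have h1 : n * (1 - η - 12 * δ) * W ≤ n * ((1 - η) * W) - 6 * k * j := by
    have : k * j ≤ δ * n * (2 * W) := mul_le_mul hkn (by linarith) hj0 (by positivity)
    linarith
  have h2 : 0 ≤ n * (1 - η - 12 * δ) * W := mul_nonneg (mul_nonneg hn0 (by linarith)) hW0
  have h3 : 0 ≤ (1 - δ) ^ 2 * p ^ 2 * (1 - c) := mul_nonneg (by positivity) (by linarith)
  calc n * p ^ 2 * (1 - g) * W = n * p ^ 2 * W * (1 - g) := by ring
    _ ≤ n * p ^ 2 * W * ((1 - δ) ^ 2 * (1 - η - 12 * δ) * (1 - c) * (1 - τ)) :=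
      mul_le_mul_of_nonneg_left hg (by positivity)
    _ = (1 - τ) * (n * (1 - η - 12 * δ) * W * ((1 - δ) ^ 2 * p ^ 2 * (1 - c))) := by ring
    _ ≤ _ := mul_le_mul_of_nonneg_left
      (mul_le_mul h1 (edge_factor_le hδ0 hp hc hj0 hjk) h3 (h2.trans h1)) (by linarith)

theorem crude_exponent_le {n : ℕ} {δ p c τ θ k j : ℝ} (hδ0 : 0 ≤ δ) (hδ1 : δ ≤ 1 / 100)
    (hp : 0 ≤ p) (hkn : k ≤ δ * n) (hc : 6 * k * p ≤ c) (hc1 : c ≤ 1 / 10) (hτ0 : 0 ≤ τ)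
    (hj0 : 0 ≤ j) (hjk : j ≤ k) (hθ : θ * k ≤ j) :
    τ * θ * (n * p ^ 2) / 8 * k ≤ τ * ((n * (j / 3) - 6 * k * j) *
      (((1 - δ) * p) ^ 2 * (1 - 6 * j * ((1 - δ) * p)))) := by
  have hn0 : (0 : ℝ) ≤ n := Nat.cast_nonneg n
  have h1 : n * j * (1 / 3 - 6 * δ) ≤ n * (j / 3) - 6 * k * j := by
    have : k * j ≤ δ * n * j := mul_le_mul_of_nonneg_right hkn hj0
    linarith
  have h2 : 0 ≤ n * j * (1 / 3 - 6 * δ) := mul_nonneg (by positivity) (by linarith)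
  have h3 : 0 ≤ (1 - δ) ^ 2 * p ^ 2 * (1 - c) := mul_nonneg (by positivity) (by linarith)
  have h5 : (1 : ℝ) / 8 ≤ (1 / 3 - 6 * δ) * ((1 - δ) ^ 2 * (1 - c)) := by
    have h6 : (98 : ℝ) / 100 ≤ (1 - δ) ^ 2 := by nlinarith
    have h7 : (98 : ℝ) / 100 * (9 / 10) ≤ (1 - δ) ^ 2 * (1 - c) :=
      mul_le_mul h6 (by linarith) (by norm_num) (by positivity)
    have h8 : (27 : ℝ) / 100 * (98 / 100 * (9 / 10)) ≤
      (1 / 3 - 6 * δ) * ((1 - δ) ^ 2 * (1 - c)) :=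
      mul_le_mul (by linarith) h7 (by norm_num) (by linarith)
    linarith
  calc τ * θ * (n * p ^ 2) / 8 * k = τ * (n * p ^ 2 * (1 / 8) * (θ * k)) := by ring
    _ ≤ τ * (n * p ^ 2 * (1 / 8) * j) := by gcongr
    _ ≤ τ * (n * p ^ 2 * ((1 / 3 - 6 * δ) * ((1 - δ) ^ 2 * (1 - c))) * j) := by gcongr
    _ = τ * (n * j * (1 / 3 - 6 * δ) * ((1 - δ) ^ 2 * p ^ 2 * (1 - c))) := by ring
    _ ≤ _ := mul_le_mul_of_nonneg_left
      (mul_le_mul h1 (edge_factor_le hδ0 hp hc hj0 hjk) h3 (h2.trans h1)) hτ0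

/-- The bound when `k` is small compared to `1 / p`. -/
theorem eventB_le_of_small {O : Finset G} (hO : OddCoset O) {n : ℕ} (hn : O.card = n)
    {δ p c η τ g θ ζ : ℝ} (hδ0 : 0 ≤ δ) (hδ1 : δ ≤ 1 / 100) (hp : 0 ≤ p) (hp1 : (1 + δ) * p ≤ 1)
    {k : ℕ} (hkn : (k : ℝ) ≤ δ * n) (hc : 6 * k * p ≤ c) (hc1 : c ≤ 1 / 10)
    (hη1 : η + 12 * δ ≤ 1) (hτ0 : 0 ≤ τ) (hτ1 : τ ≤ 1)
    (hg : 1 - g ≤ (1 - δ) ^ 2 * (1 - η - 12 * δ) * (1 - c) * (1 - τ))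
    (hu : 1 ≤ 2 * (n * p ^ 2))
    {κ : Type*} [DecidableEq κ] (cl : G → κ) {D : ℕ}
    (hD : ∀ s, (Finset.univ.filter fun t => cl t = cl s).card ≤ D)
    {w : G → ℝ} (hw : ∀ s, 1 / 2 ≤ w s)
    (hsharp : ∀ S' ⊆ Oᶜ.erase 0, Set.InjOn cl S' → S'.card ≤ k →
      n * (1 - η) * ∑ s ∈ S', w s ≤ (schurGraph O S').card)
    (hcrude : ∀ S ∈ (Oᶜ.erase 0).powersetCard k, ∃ S' ⊆ S, θ * k ≤ S'.card ∧
      n * (S'.card : ℝ) / 3 ≤ (schurGraph O S').card)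
    (hZ : (1 + δ) * p * ∑ s ∈ Oᶜ.erase 0, Real.exp (-(n * p ^ 2 * (1 - g) * w s)) ≤ ζ)
    (hDζ : D * ((1 + δ) * p) ≤ ζ) :
    randomSubsetProb (biasedProb O δ p) (EventB O k) ≤
      (4 * Real.exp 1 ^ 2 * (n * p ^ 2) * ζ * Real.exp (-(τ * θ * (n * p ^ 2) / 8))) ^ k := by
  classical
  obtain ⟨hq0, hq1, hqO, hqE⟩ := biasedProb_bounds O hδ0 (by linarith) hp hp1
  set u : ℝ := n * p ^ 2 with hudef
  have hu0 : 0 ≤ u := by positivity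
  set b := (1 + δ) * p with hb
  have hb0 : 0 ≤ b := by positivity
  set f : G → ℝ := fun s => Real.exp (-(u * (1 - g) * w s)) with hf
  have hk0 : (0 : ℝ) ≤ k := Nat.cast_nonneg k
  set B : ℝ := b ^ k * ((Real.exp 1 * (2 * u)) ^ k * Real.exp (-(τ * θ * u / 8)) ^ k) with hBdef
  have hB : 0 ≤ B := by positivity
  have hperS : ∀ S ∈ (Oᶜ.erase 0).powersetCard k, ∀ S' ⊆ S, ∀ m : ℝ,
      n * m ≤ (schurGraph O S').card →
      ev (biasedProb O δ p) (fun A => ind (S ⊆ A ∧ ∃ T : Finset G, T.card ≤ k ∧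
        ∀ e ∈ schurGraph O S, e ⊆ A → ¬ Disjoint e T)) ≤
      b ^ k * ((Real.exp 1 * (2 * u)) ^ k *
        Real.exp (-((n * m - 6 * k * S'.card) *
          (((1 - δ) * p) ^ 2 * (1 - 6 * S'.card * ((1 - δ) * p)))))) := by
    intro S hS S' hS' m hm
    have hj : (S'.card : ℝ) ≤ k := by
      have := Finset.card_le_card hS'
      rw [(Finset.mem_powersetCard.1 hS).2] at this
      exact_mod_cast this
    have hjp : (S'.card : ℝ) * p ≤ k * p := mul_le_mul_of_nonneg_right hj hp
    refine ev_schurGraph_cover_le hO (p := p) (mul_nonneg (by linarith) hp) le_rfl ?_ ?_ hp1 hqO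
      hqE hS hS' hm ?_ hu ?_
    · nlinarith
    · rw [hb]; nlinarith
    · have : 0 ≤ (S'.card : ℝ) * p := by positivity
      nlinarith
    · rw [hn, hudef]
      nlinarith [mul_le_mul_of_nonneg_right hj hu0]
  have hmain : ∀ S ∈ (Oᶜ.erase 0).powersetCard k, ∀ S' ⊆ S, Set.InjOn cl S' →
      ev (biasedProb O δ p) (fun A => ind (S ⊆ A ∧ ∃ T : Finset G, T.card ≤ k ∧
        ∀ e ∈ schurGraph O S, e ⊆ A → ¬ Disjoint e T)) ≤ B * ∏ s ∈ S', f s := by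
    intro S hS S' hS' hinj
    have hSk := (Finset.mem_powersetCard.1 hS).2
    set W := ∑ s ∈ S', w s with hW
    have hWj : (S'.card : ℝ) / 2 ≤ W := by
      have := Finset.card_nsmul_le_sum S' w (1 / 2) fun s _ => hw s
      rw [nsmul_eq_mul] at this
      linarith
    have hW0 : 0 ≤ W := le_trans (by positivity) hWj
    have hjk : ∀ S' ⊆ S, (S'.card : ℝ) ≤ k := fun S' hS' => by
      have := Finset.card_le_card hS'
      rw [hSk] at this
      exact_mod_cast this
    have hX1 := hperS S hS S' hS' ((1 - η) * W) (by
      rw [← mul_assoc]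
      exact hsharp S' (hS'.trans (Finset.mem_powersetCard.1 hS).1) hinj
        (by have := Finset.card_le_card hS'; omega))
    -- `S'` may be much smaller than `S`, so its exponent need not grow with `k`. The set `S₂`
    -- restores a gain exponential in `u * k`.
    obtain ⟨S₂, hS₂, hθS, hS₂m⟩ := hcrude S hS
    have hX2 := hperS S hS S₂ hS₂ (S₂.card / 3) (by linarith)
    set X1 := (n * ((1 - η) * W) - 6 * k * S'.card) *
          (((1 - δ) * p) ^ 2 * (1 - 6 * S'.card * ((1 - δ) * p))) with hX1d
    set X2 := (n * ((S₂.card : ℝ) / 3) - 6 * k * S₂.card) *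
          (((1 - δ) * p) ^ 2 * (1 - 6 * S₂.card * ((1 - δ) * p))) with hX2d
    have hn0 : (0 : ℝ) ≤ n := Nat.cast_nonneg n
    have hlow1 : u * (1 - g) * W ≤ (1 - τ) * X1 :=
      sharp_exponent_le hδ0 hp hkn hc (by linarith) hη1 hτ1 hg
        (Nat.cast_nonneg _) (hjk S' hS') hWj
    have hlow2 : τ * θ * u / 8 * k ≤ τ * X2 :=
      crude_exponent_le hδ0 hδ1 hp hkn hc hc1 hτ0 (Nat.cast_nonneg _) (hjk S₂ hS₂) hθS
    have hmax : ev (biasedProb O δ p) (fun A => ind (S ⊆ A ∧ ∃ T : Finset G, T.card ≤ k ∧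
        ∀ e ∈ schurGraph O S, e ⊆ A → ¬ Disjoint e T)) ≤
        b ^ k * ((Real.exp 1 * (2 * u)) ^ k * Real.exp (-((1 - τ) * X1 + τ * X2))) := by
      rw [← mul_assoc] at hX1 hX2 ⊢
      exact le_mul_exp_interpolate (by positivity) hτ0 hτ1 hX1 hX2
    refine hmax.trans ?_
    have hprod : ∏ s ∈ S', f s = Real.exp (-(u * (1 - g) * W)) := by
      rw [hf, ← Real.exp_sum, hW, Finset.mul_sum, Finset.sum_neg_distrib]
    rw [hprod, hBdef, mul_assoc, mul_assoc, ← Real.exp_nat_mul, ← Real.exp_add]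
    gcongr
    linarith
  refine (randomSubsetProb_eventB_le hO hq0 hq1 k).trans ?_
  refine (sum_le_of_transversal cl hD _ k hB (fun s => (Real.exp_pos _).le) hmain).trans ?_
  have hfin := sum_pow_mul_choose_le (k := k) (D := D) hb0
    (Finset.sum_nonneg fun s (_ : s ∈ Oᶜ.erase 0) => (Real.exp_pos (-(u * (1 - g) * w s))).le)
    hZ hDζ
  calc _ = (Real.exp 1 * (2 * u)) ^ k * Real.exp (-(τ * θ * u / 8)) ^ k *
        (b ^ k * ∑ j ∈ Finset.range (k + 1), (∑ s ∈ Oᶜ.erase 0, f s) ^ j *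
          ((j * D).choose (k - j) : ℝ)) := by rw [hBdef]; ring
    _ ≤ (Real.exp 1 * (2 * u)) ^ k * Real.exp (-(τ * θ * u / 8)) ^ k *
        (2 * Real.exp 1 * ζ) ^ k := mul_le_mul_of_nonneg_left hfin (by positivity)
    _ = _ := by rw [← mul_pow, ← mul_pow]; congr 1; ring

/-- The bound when `k` is large. -/
theorem eventB_le_of_large {O : Finset G} (hO : OddCoset O) {n : ℕ} (hn : O.card = n)
    (hG : Fintype.card G = 2 * n)
    {δ p θ : ℝ} (hδ0 : 0 ≤ δ) (hδ1 : δ ≤ 1 / 100) (hp : 0 < p) (hp1 : (1 + δ) * p ≤ 1)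
    {k : ℕ} (hk : 1 ≤ k) (hkn : (k : ℝ) ≤ δ * p * n)
    (hcrude : ∀ S ∈ (Oᶜ.erase 0).powersetCard k, ∃ S' ⊆ S, θ * k ≤ S'.card ∧
      ∀ S'' ⊆ S', n * (S''.card : ℝ) / 3 ≤ (schurGraph O S'').card) :
    randomSubsetProb (biasedProb O δ p) (EventB O k) ≤
      (2 * Real.exp 1 * (n * p / k)) ^ (2 * k) *
        Real.exp (-(min (n * p ^ 2 * (θ * k)) (n * p / 2) / 1200)) := by
  obtain ⟨hq0, hq1, hqO, hqE⟩ := biasedProb_bounds O hδ0 (by linarith) hp.le hp1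
  have hp1' : p ≤ 1 := by nlinarith
  have hk' : (0 : ℝ) < k := by exact_mod_cast hk
  have hn0 : (0 : ℝ) ≤ n := Nat.cast_nonneg n
  set M := min (n * p ^ 2 * (θ * k)) (n * p / 2) with hM
  set y := n * p / (k : ℝ) with hy
  have hy1 : 1 ≤ 2 * y := by
    have : 1 ≤ y := by
      rw [hy, le_div_iff₀ hk']
      have : δ * (p * n) ≤ 1 * (p * n) := mul_le_mul_of_nonneg_right (by linarith) (by positivity)
      linarith
    linarith
  have hmain : ∀ S ∈ (Oᶜ.erase 0).powersetCard k,
      ev (biasedProb O δ p) (fun A => ind (S ⊆ A ∧ ∃ T : Finset G, T.card ≤ k ∧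
        ∀ e ∈ schurGraph O S, e ⊆ A → ¬ Disjoint e T)) ≤
      ((1 + δ) * p) ^ k * ((Real.exp 1 * (2 * y)) ^ k * Real.exp (-(M / 1200))) := by
    intro S hS
    obtain ⟨S₁, hS₁, hθ, hm⟩ := hcrude S hS
    -- Truncating at `1 / p` elements keeps the degree times the density bounded; the density `(1 -
    -- δ) p / 12` used below then makes `6 * S₂.card * c ≤ 1 / 2`.
    obtain ⟨S₂, hS₂, hc2⟩ := Finset.exists_subset_card_eq (s := S₁)
      (n := min S₁.card ⌊1 / p⌋₊) (min_le_left _ _)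
    have hj1 : (S₂.card : ℝ) * p ≤ 1 := by
      have h1 : (S₂.card : ℝ) ≤ (⌊1 / p⌋₊ : ℝ) := by
        rw [hc2]; exact_mod_cast min_le_right _ _
      have h2 : (⌊1 / p⌋₊ : ℝ) ≤ 1 / p := Nat.floor_le (by positivity)
      exact (le_div_iff₀ hp).1 (h1.trans h2)
    have hj2 : M ≤ n * p ^ 2 * S₂.card := by
      rcases min_choice S₁.card ⌊1 / p⌋₊ with h | h
      · rw [hc2, h]
        exact (min_le_left _ _).trans (mul_le_mul_of_nonneg_left hθ (by positivity))
      · rw [hc2, h]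
        refine (min_le_right _ _).trans ?_
        have h1 : 1 / p < ⌊1 / p⌋₊ + 1 := Nat.lt_floor_add_one _
        have h2 : (1 : ℝ) ≤ ⌊1 / p⌋₊ := by
          exact_mod_cast Nat.le_floor (by rw [Nat.cast_one]; exact (one_le_div hp).2 hp1')
        have h3 : 1 / p ≤ 2 * ⌊1 / p⌋₊ := by linarith
        rw [div_le_iff₀ hp] at h3
        have : n * p * 1 ≤ n * p * (2 * ⌊1 / p⌋₊ * p) :=
          mul_le_mul_of_nonneg_left h3 (by positivity)
        nlinarith
    refine (ev_schurGraph_cover_le hO (p := p) (c := (1 - δ) * p / 12) (z := 2 * y)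
      (m := n * (S₂.card : ℝ) / 3)
      (by have : 0 ≤ (1 - δ) * p := mul_nonneg (by linarith) hp.le
          linarith) ?_ ?_ ?_ hp1 hqO hqE hS (hS₂.trans hS₁) (hm S₂ hS₂) ?_ hy1 ?_).trans ?_
    · have : 0 ≤ (1 - δ) * p := mul_nonneg (by linarith) hp.le
      linarith
    · nlinarith
    · nlinarith
    · have : 0 ≤ (S₂.card : ℝ) * p := by positivity
      nlinarith
    · rw [hn, hy]
      have : (k : ℝ) * (2 * (n * p / k)) = 2 * n * p := by field_simp
      rw [this]
      have : 2 * n * p * (S₂.card * p) ≤ 2 * n * p * 1 :=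
        mul_le_mul_of_nonneg_left hj1 (by positivity)
      nlinarith
    · refine mul_le_mul_of_nonneg_left (mul_le_mul_of_nonneg_left (Real.exp_le_exp.2 ?_)
        (by positivity)) (by positivity)
      rw [neg_le_neg_iff]
      have hkn' : (k : ℝ) ≤ δ * n := by
        have : δ * n * p ≤ δ * n * 1 := mul_le_mul_of_nonneg_left hp1' (by positivity)
        linarith
      have h1 : n * (S₂.card : ℝ) * (27 / 100) ≤ n * (S₂.card : ℝ) / 3 - 6 * k * S₂.card := by
        have h2 : (k : ℝ) * S₂.card ≤ δ * n * S₂.card :=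
          mul_le_mul_of_nonneg_right hkn' (by positivity)
        have h3 : δ * (n * S₂.card) ≤ 1 / 100 * (n * S₂.card) :=
          mul_le_mul_of_nonneg_right hδ1 (by positivity)
        nlinarith
      have h4 : p ^ 2 * (98 / 100 / 288) ≤
          ((1 - δ) * p / 12) ^ 2 * (1 - 6 * S₂.card * ((1 - δ) * p / 12)) := by
        have h5 : (98 : ℝ) / 100 ≤ (1 - δ) ^ 2 := by nlinarith
        have h6 : (1 : ℝ) / 2 ≤ 1 - 6 * S₂.card * ((1 - δ) * p / 12) := by
          have : 0 ≤ (S₂.card : ℝ) * p := by positivity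
          nlinarith
        calc p ^ 2 * (98 / 100 / 288) = p ^ 2 * (98 / 100) / 144 * (1 / 2) := by ring
          _ ≤ p ^ 2 * (1 - δ) ^ 2 / 144 * (1 - 6 * S₂.card * ((1 - δ) * p / 12)) := by
            refine mul_le_mul ?_ h6 (by norm_num) (by positivity)
            gcongr
          _ = _ := by ring
      calc M / 1200 ≤ n * p ^ 2 * S₂.card / 1200 := by linarith
        _ ≤ n * (S₂.card : ℝ) * (27 / 100) * (p ^ 2 * (98 / 100 / 288)) := by
          have : 0 ≤ n * p ^ 2 * (S₂.card : ℝ) := by positivity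
          nlinarith
        _ ≤ _ := mul_le_mul h1 h4 (by positivity) (le_trans (by positivity) h1)
  have hU : (Oᶜ.erase 0).card ≤ n := by
    refine (Finset.card_erase_le).trans ?_
    rw [Finset.card_compl, hn, hG]; omega
  refine (randomSubsetProb_eventB_le hO hq0 hq1 k).trans ((Finset.sum_le_sum hmain).trans ?_)
  rw [Finset.sum_const, Finset.card_powersetCard, nsmul_eq_mul, ← mul_assoc]
  -- Choosing `S` contributes the same factor as choosing the matching, hence the exponent `2 * k`.
  have h1 : (((Oᶜ.erase 0).card.choose k : ℕ) : ℝ) * ((1 + δ) * p) ^ k ≤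
      (Real.exp 1 * (2 * y)) ^ k := by
    refine (choose_mul_pow_le (x := 2 * (n * p)) (by positivity) ?_).trans
      ((pow_div_factorial_le_pow _ (by positivity) k hk).trans ?_)
    · have h2 : ((Oᶜ.erase 0).card : ℝ) ≤ n := by exact_mod_cast hU
      calc ((Oᶜ.erase 0).card : ℝ) * ((1 + δ) * p) ≤ n * (2 * p) := by
            refine mul_le_mul h2 ?_ (by positivity) hn0
            nlinarith
        _ = _ := by ring
    · rw [hy, mul_div_assoc]
  calc _ ≤ (Real.exp 1 * (2 * y)) ^ k * ((Real.exp 1 * (2 * y)) ^ k * Real.exp (-(M / 1200))) :=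
        mul_le_mul_of_nonneg_right h1 (by positivity)
    _ = _ := by rw [two_mul k, pow_add]; ring

end Regimes

/-! ### Edge weights when elements of order two are rare or abundant -/

section Counting

variable {G : Type*} [AddCommGroup G] [Fintype G] [DecidableEq G] {O : Finset G}

/-- The subgroup of doubles. -/
def doubles (G : Type*) [AddCommGroup G] : AddSubgroup G := (nsmulAddMonoidHom 2 : G →+ G).range

theorem mem_doubles {x : G} : x ∈ doubles G ↔ ∃ g, g + g = x := by
  simp [doubles, AddMonoidHom.mem_range, two_nsmul]

theorem card_doubles_mul_r : Nat.card (doubles G) * r G = Fintype.card G := card_range_two_mul_r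

theorem r_pos : 0 < r G := by
  have := card_doubles_mul_r (G := G)
  have h : 0 < Fintype.card G := Fintype.card_pos
  rw [← this] at h
  exact Nat.pos_of_mul_pos_left h

theorem card_doubles_pos : 0 < Nat.card (doubles G) := Nat.card_pos

theorem card_coset_doubles [DecidableEq (G ⧸ doubles G)] (s : G) :
    (Finset.univ.filter fun t : G => (t : G ⧸ doubles G) = (s : G ⧸ doubles G)).card ≤
      Nat.card (doubles G) := by
  classical
  rw [Nat.card_eq_fintype_card, ← Finset.card_univ]
  refine Finset.card_le_card_of_injOn
    (fun t => if h : -s + t ∈ doubles G then ⟨-s + t, h⟩ else 0) (fun _ _ => Finset.mem_univ _) ?_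
  intro t ht t' ht' h
  simp only [Finset.coe_filter, Finset.mem_univ, true_and, Set.mem_ofPred_eq] at ht ht'
  have h1 : -s + t ∈ doubles G := QuotientAddGroup.eq.1 ht.symm
  have h2 : -s + t' ∈ doubles G := QuotientAddGroup.eq.1 ht'.symm
  simp only [h1, h2, dif_pos, Subtype.mk.injEq] at h
  exact add_left_cancel h

theorem card_sym_class [DecidableEq (Sym2 G)] (s : G) :
    (Finset.univ.filter fun t : G => s(t, -t) = s(s, -s)).card ≤ 2 := by
  refine (Finset.card_le_card (t := {s, -s}) fun t ht => ?_).trans Finset.card_le_two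
  rw [Finset.mem_filter, Sym2.eq_iff] at ht
  rcases ht.2 with ⟨h, -⟩ | ⟨h, -⟩ <;> simp [h]

theorem card_schurGraph_of_injOn_mk {S : Finset G} (hS : S ⊆ Oᶜ.erase 0)
    (hinj : Set.InjOn (fun s : G => (s : G ⧸ doubles G)) S) :
    ∑ s ∈ S, (schurEdges O s).card ≤ (schurGraph O S).card := by
  have := sum_card_le_card_schurGraph (O := O) (w := 0) S fun s hs t ht hst => by
    rw [Finset.disjoint_iff_inter_eq_empty.1 (disjoint_schurEdges
      (Finset.ne_of_mem_erase (hS hs)) (Finset.ne_of_mem_erase (hS ht)) fun g hg => ?_)]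
    · simp
    · refine hst (hinj hs ht ?_)
      refine (QuotientAddGroup.eq.2 ?_).symm
      rw [mem_doubles]
      exact ⟨g, by rw [← hg]; abel⟩
  simpa using this

theorem card_schurGraph_of_injOn_sym {S : Finset G}
    (hinj : Set.InjOn (fun s : G => s(s, -s)) S) :
    ∑ s ∈ S, (schurEdges O s).card ≤ (schurGraph O S).card + 2 * r G * S.card ^ 2 :=
  sum_card_le_card_schurGraph S fun s hs t ht hst => by
    refine card_inter_schurEdges_le hst fun h => hst (hinj hs ht ?_)
    simp [h, Sym2.eq_swap]

/-- The weight of `s` when few elements have order two. -/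
noncomputable def sparseWeight (s : G) : ℝ := if s + s = 0 then 1 else 3 / 2

theorem one_le_sparseWeight (s : G) : 1 ≤ sparseWeight s := by
  unfold sparseWeight; split_ifs <;> norm_num

theorem sparseWeight_le_card (hO : OddCoset O) {n : ℕ} (hn : O.card = n) {δ : ℝ}
    (hr : (r G : ℝ) ≤ δ * n) {s : G} (hs : s ∈ Oᶜ.erase 0) :
    n * (1 - δ) * sparseWeight s ≤ (schurEdges O s).card := by
  have hsO : s ∉ O := by simpa using (Finset.mem_erase.1 hs).2
  have h1 := card_odd_filter_add_self_eq_le O s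
  have h2 := two_mul_card_odd_filter_le hO
  have hn0 : (0 : ℝ) ≤ r G := Nat.cast_nonneg _
  unfold sparseWeight
  split_ifs with h0
  · have h3 := card_schurEdges_of_add_self_eq_zero (O := O) h0
    rw [hn] at h3
    have : n ≤ (schurEdges O s).card + r G := by omega
    have : (n : ℝ) ≤ (schurEdges O s).card + r G := by exact_mod_cast this
    linarith
  · have h3 := card_schurEdges_of_add_self_ne_zero hO hsO h0
    rw [hn] at h3
    have : 3 * n ≤ 2 * (schurEdges O s).card + 2 * r G := by omega
    have : 3 * (n : ℝ) ≤ 2 * (schurEdges O s).card + 2 * r G := by exact_mod_cast this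
    linarith

/-- Sum edges alone suffice: they are disjoint for different `s`, and each `s` has nearly `n / 2` of
them. No transversal is needed. -/
theorem third_mul_card_le_schurGraph (hO : OddCoset O) {n : ℕ} (hn : O.card = n)
    (hr : (r G : ℝ) ≤ 1 / 100 * n) {S : Finset G} (hS : S ⊆ Oᶜ.erase 0) :
    n * (S.card : ℝ) / 3 ≤ (schurGraph O S).card := by
  have h1 : ∀ s ∈ S, (n : ℝ) / 3 ≤ (sumEdges O s).card := fun s hs => by
    have hsO : s ∉ O := by simpa using (Finset.mem_erase.1 (hS hs)).2
    have h1 := card_odd_filter_add_self_eq_le O s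
    have h2 := two_mul_card_odd_filter_le hO
    have h3 := two_mul_card_le_sumEdges hO hsO
    rw [hn] at h3
    have : n ≤ 2 * (sumEdges O s).card + 2 * r G := by omega
    have : (n : ℝ) ≤ 2 * (sumEdges O s).card + 2 * r G := by exact_mod_cast this
    linarith
  have h2 : ∑ s ∈ S, (sumEdges O s).card ≤ (schurGraph O S).card := by
    rw [← Finset.card_biUnion fun s _ t _ hst => disjoint_sumEdges hst]
    exact Finset.card_le_card (Finset.biUnion_mono fun s _ => Finset.subset_union_left)
  calc n * (S.card : ℝ) / 3 = ∑ _s ∈ S, (n : ℝ) / 3 := by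
        rw [Finset.sum_const, nsmul_eq_mul]; ring
    _ ≤ ∑ s ∈ S, ((sumEdges O s).card : ℝ) := Finset.sum_le_sum h1
    _ ≤ _ := by exact_mod_cast h2

theorem sparse_sharp_mk (hO : OddCoset O) {n : ℕ} (hn : O.card = n) {δ : ℝ}
    (hr : (r G : ℝ) ≤ δ * n) {S : Finset G} (hS : S ⊆ Oᶜ.erase 0)
    (hinj : Set.InjOn (fun s : G => (s : G ⧸ doubles G)) S) :
    n * (1 - δ) * ∑ s ∈ S, sparseWeight s ≤ (schurGraph O S).card := by
  rw [Finset.mul_sum]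
  refine (Finset.sum_le_sum fun s hs => sparseWeight_le_card hO hn hr (hS hs)).trans ?_
  exact_mod_cast card_schurGraph_of_injOn_mk hS hinj

/-- The pairwise overlaps total at most `2 r k` per element of `S`, a fraction `η` of `n` by `hrk`.
-/
theorem sparse_sharp_sym (hO : OddCoset O) {n k : ℕ} (hn : O.card = n) {δ η : ℝ}
    (hr : (r G : ℝ) ≤ δ * n) (hrk : 2 * (r G : ℝ) * k ≤ η * n) {S : Finset G}
    (hS : S ⊆ Oᶜ.erase 0) (hSk : S.card ≤ k) (hinj : Set.InjOn (fun s : G => s(s, -s)) S) :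
    n * (1 - (δ + η)) * ∑ s ∈ S, sparseWeight s ≤ (schurGraph O S).card := by
  have h1 : n * (1 - δ) * ∑ s ∈ S, sparseWeight s ≤
      (schurGraph O S).card + 2 * r G * (S.card : ℝ) ^ 2 := by
    rw [Finset.mul_sum]
    refine (Finset.sum_le_sum fun s hs => sparseWeight_le_card hO hn hr (hS hs)).trans ?_
    exact_mod_cast card_schurGraph_of_injOn_sym hinj
  have h2 : (S.card : ℝ) ≤ ∑ s ∈ S, sparseWeight s := by
    have := Finset.card_nsmul_le_sum S sparseWeight 1 fun s _ => one_le_sparseWeight s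
    rwa [nsmul_eq_mul, mul_one] at this
  have hSk' : (S.card : ℝ) ≤ k := by exact_mod_cast hSk
  have h3 : 2 * r G * (S.card : ℝ) ^ 2 ≤ η * n * ∑ s ∈ S, sparseWeight s := by
    calc 2 * r G * (S.card : ℝ) ^ 2 = 2 * r G * (S.card : ℝ) * S.card := by ring
      _ ≤ 2 * r G * (k : ℝ) * S.card := by gcongr
      _ ≤ η * n * ∑ s ∈ S, sparseWeight s :=
        mul_le_mul hrk h2 (by positivity) (le_trans (by positivity) hrk)
  linarith

open Classical in
/-- The weight of `s` when many elements have order two. -/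
noncomputable def denseWeight (β : ℝ) (s : G) : ℝ := if s ∈ doubles G then 1 / 2 else (4 - β) / 4

theorem half_le_denseWeight {β : ℝ} (hβ : β ≤ 2) (s : G) : 1 / 2 ≤ denseWeight β s := by
  unfold denseWeight; split_ifs <;> linarith

theorem half_le_card_schurEdges {n : ℕ} (hn : O.card = n) (s : G) :
    (n : ℝ) / 2 ≤ (schurEdges O s).card := by
  have h1 := card_le_two_mul_diffEdges (O := O) s
  have h2 := card_schurEdges (O := O) s
  have : n ≤ 2 * (schurEdges O s).card := by omega
  have : (n : ℝ) ≤ 2 * (schurEdges O s).card := by exact_mod_cast this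
  linarith

theorem denseWeight_le_card (hO : OddCoset O) {n : ℕ} (hn : O.card = n) {β : ℝ}
    (hβ : (r G : ℝ) = β * n) (hβ2 : β ≤ 2) {s : G} (hs : s ∈ Oᶜ.erase 0) :
    n * denseWeight β s ≤ (schurEdges O s).card := by
  have hsO : s ∉ O := by simpa using (Finset.mem_erase.1 hs).2
  unfold denseWeight
  split_ifs with hd
  · linarith [half_le_card_schurEdges hn s]
  · have h1 : (O.filter fun x => x + x = s).card = 0 := by
      rw [Finset.card_eq_zero, Finset.filter_eq_empty_iff]
      exact fun x _ h => hd (mem_doubles.2 ⟨x, h⟩)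
    have h2 := two_mul_card_odd_filter_le hO
    by_cases h0 : s + s = 0
    · have h3 := card_schurEdges_of_add_self_eq_zero (O := O) h0
      rw [hn] at h3
      have : 4 * n ≤ 4 * (schurEdges O s).card + r G := by omega
      have : 4 * (n : ℝ) ≤ 4 * (schurEdges O s).card + r G := by exact_mod_cast this
      linarith
    -- Here the count is at least `(3 - β) n / 2`, and `β ≤ 2` makes this no smaller than `(4 - β) n
    -- / 4`.
    · have h3 := card_schurEdges_of_add_self_ne_zero hO hsO h0
      rw [hn] at h3
      have : 3 * n ≤ 2 * (schurEdges O s).card + r G := by omega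
      have : 3 * (n : ℝ) ≤ 2 * (schurEdges O s).card + r G := by exact_mod_cast this
      have : β * n ≤ 2 * n := mul_le_mul_of_nonneg_right hβ2 (Nat.cast_nonneg n)
      linarith

theorem dense_sharp (hO : OddCoset O) {n : ℕ} (hn : O.card = n) {β : ℝ}
    (hβ : (r G : ℝ) = β * n) (hβ2 : β ≤ 2) {S : Finset G} (hS : S ⊆ Oᶜ.erase 0)
    (hinj : Set.InjOn (fun s : G => (s : G ⧸ doubles G)) S) :
    n * ∑ s ∈ S, denseWeight β s ≤ (schurGraph O S).card := by
  rw [Finset.mul_sum]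
  refine (Finset.sum_le_sum fun s hs => denseWeight_le_card hO hn hβ hβ2 (hS hs)).trans ?_
  exact_mod_cast card_schurGraph_of_injOn_mk hS hinj

/-- A transversal modulo `2G` retains at least a `1 / |2G|` proportion of `S`, and every `s` keeps
at least `n / 2` difference edges. -/
theorem dense_crude {n : ℕ} (hn : O.card = n) {S : Finset G} (hS : S ⊆ Oᶜ.erase 0) :
    ∃ S' ⊆ S, 1 / (Nat.card (doubles G) : ℝ) * S.card ≤ S'.card ∧
      ∀ S'' ⊆ S', n * (S''.card : ℝ) / 3 ≤ (schurGraph O S'').card := by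
  classical
  obtain ⟨S', hS', hinj, htr⟩ := exists_transversal (fun s : G => (s : G ⧸ doubles G)) S
  refine ⟨S', hS', ?_, fun S'' hS'' => ?_⟩
  · have h1 : S ⊆ S'.biUnion fun s =>
        Finset.univ.filter fun t : G => (t : G ⧸ doubles G) = (s : G ⧸ doubles G) := fun t ht => by
      obtain ⟨s, hs, e⟩ := htr t ht
      exact Finset.mem_biUnion.2 ⟨s, hs, by simpa using e⟩
    have h2 := (Finset.card_le_card h1).trans
      (Finset.card_biUnion_le_card_mul _ _ _ fun s _ => card_coset_doubles s)
    have h3 : (S.card : ℝ) ≤ S'.card * Nat.card (doubles G) := by exact_mod_cast h2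
    have h4 : (0 : ℝ) < Nat.card (doubles G) := by exact_mod_cast card_doubles_pos
    rw [one_div, inv_mul_le_iff₀ h4]
    linarith
  · have h1 := card_schurGraph_of_injOn_mk (O := O) ((hS''.trans hS').trans hS)
      (hinj.mono (Finset.coe_subset.2 hS''))
    have h2 : ∑ _s ∈ S'', (n : ℝ) / 2 ≤ ∑ s ∈ S'', ((schurEdges O s).card : ℝ) :=
      Finset.sum_le_sum fun s _ => half_le_card_schurEdges hn s
    have h3 : ∑ s ∈ S'', ((schurEdges O s).card : ℝ) ≤ (schurGraph O S'').card := by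
      exact_mod_cast h1
    rw [Finset.sum_const, nsmul_eq_mul] at h2
    have : (0 : ℝ) ≤ n * S''.card := by positivity
    linarith

theorem sum_exp_sparseWeight_le {n : ℕ} (hn : (Oᶜ.erase 0).card ≤ n) (x : ℝ) :
    ∑ s ∈ Oᶜ.erase 0, Real.exp (-(x * sparseWeight s)) ≤
      r G * Real.exp (-x) + n * Real.exp (-(3 / 2 * x)) := by
  calc ∑ s ∈ Oᶜ.erase 0, Real.exp (-(x * sparseWeight s))
      ≤ ∑ s ∈ Oᶜ.erase 0, ((if s + s = 0 then Real.exp (-x) else 0) +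
          Real.exp (-(3 / 2 * x))) := by
        refine Finset.sum_le_sum fun s _ => ?_
        unfold sparseWeight
        split_ifs
        · rw [mul_one]; linarith [Real.exp_pos (-(3 / 2 * x))]
        · rw [zero_add, mul_comm]
    _ = ((Oᶜ.erase 0).filter fun s => s + s = 0).card * Real.exp (-x) +
          (Oᶜ.erase 0).card * Real.exp (-(3 / 2 * x)) := by
        rw [Finset.sum_add_distrib, ← Finset.sum_filter, Finset.sum_const, Finset.sum_const,
          nsmul_eq_mul, nsmul_eq_mul]
    _ ≤ _ := by
        have h1 : ((Oᶜ.erase 0).filter fun s => s + s = 0).card ≤ r G :=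
          card_odd_filter_add_self_eq_le _ 0
        have h1' : (((Oᶜ.erase 0).filter fun s => s + s = 0).card : ℝ) ≤ r G := by exact_mod_cast h1
        have h2 : ((Oᶜ.erase 0).card : ℝ) ≤ n := by exact_mod_cast hn
        gcongr

theorem sum_exp_denseWeight_le {n : ℕ} (hn : (Oᶜ.erase 0).card ≤ n) (β x : ℝ) :
    ∑ s ∈ Oᶜ.erase 0, Real.exp (-(x * denseWeight β s)) ≤
      Nat.card (doubles G) * Real.exp (-(x / 2)) + n * Real.exp (-(x * ((4 - β) / 4))) := by
  classical
  calc ∑ s ∈ Oᶜ.erase 0, Real.exp (-(x * denseWeight β s))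
      ≤ ∑ s ∈ Oᶜ.erase 0, ((if s ∈ doubles G then Real.exp (-(x / 2)) else 0) +
          Real.exp (-(x * ((4 - β) / 4)))) := by
        refine Finset.sum_le_sum fun s _ => ?_
        unfold denseWeight
        split_ifs
        · rw [mul_one_div]; linarith [Real.exp_pos (-(x * ((4 - β) / 4)))]
        · rw [zero_add]
    _ = ((Oᶜ.erase 0).filter fun s => s ∈ doubles G).card * Real.exp (-(x / 2)) +
          (Oᶜ.erase 0).card * Real.exp (-(x * ((4 - β) / 4))) := by
        rw [Finset.sum_add_distrib, ← Finset.sum_filter, Finset.sum_const, Finset.sum_const,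
          nsmul_eq_mul, nsmul_eq_mul]
    _ ≤ _ := by
        have h1 : ((Oᶜ.erase 0).filter fun s => s ∈ doubles G).card ≤ Nat.card (doubles G) := by
          rw [Nat.card_eq_fintype_card, Fintype.card_subtype]
          exact Finset.card_le_card (Finset.filter_subset_filter _ (Finset.subset_univ _))
        have h1' : (((Oᶜ.erase 0).filter fun s => s ∈ doubles G).card : ℝ) ≤
          Nat.card (doubles G) := by exact_mod_cast h1
        have h2 : ((Oᶜ.erase 0).card : ℝ) ≤ n := by exact_mod_cast hn
        gcongr

end Counting

/-! ### Choice of constants and numerical inequalities -/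

section Numerics

theorem exists_forall_sq_le_exp (C : ℝ) {b : ℝ} (hb : 0 < b) :
    ∃ X : ℝ, 1 ≤ X ∧ ∀ x, X ≤ x → C * x ^ 2 ≤ Real.exp (b * x) := by
  have h := (isLittleO_pow_exp_pos_mul_atTop 2 hb).def (c := 1 / (|C| + 1)) (by positivity)
  obtain ⟨X, hX⟩ := Filter.eventually_atTop.1 h
  refine ⟨max X 1, le_max_right _ _, fun x hx => ?_⟩
  have h1 := hX x ((le_max_left _ _).trans hx)
  rw [Real.norm_of_nonneg (by positivity), Real.norm_of_nonneg (Real.exp_pos _).le,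
    one_div, inv_mul_eq_div, le_div_iff₀ (by positivity)] at h1
  nlinarith [le_abs_self C, sq_nonneg x]

theorem exp_half_log {n : ℕ} (hn : 1 ≤ n) : Real.exp (Real.log n / 2) = √(n : ℝ) := by
  rw [Real.exp_half, Real.exp_log (by exact_mod_cast hn)]

theorem mul_sqrt_le {n : ℕ} {δ p : ℝ} (hδ1 : δ ≤ 1) (hp : 0 ≤ p) :
    (1 + δ) * p * √(n : ℝ) ≤ 2 * √(n * p ^ 2) := by
  rw [Real.sqrt_mul (Nat.cast_nonneg n), Real.sqrt_sq hp]
  have : 0 ≤ p * √(n : ℝ) := by positivity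
  nlinarith

/-- The factor `(1 + ε)²` above the threshold pays for the loss `ε / 8` and still leaves a surplus
`ε u / 20`. -/
theorem slack_le {ε x u : ℝ} (hε : 0 < ε) (hε1 : ε ≤ 1) (hx : 0 ≤ x) (h : (1 + ε) ^ 2 * x ≤ u) :
    x + ε / 20 * u ≤ u * (1 - ε / 8) := by
  have h1 : 1 ≤ (1 - ε / 8 - ε / 20) * (1 + ε) ^ 2 := by nlinarith [mul_pos hε hε]
  have h2 : (1 - ε / 8 - ε / 20) * ((1 + ε) ^ 2 * x) ≤ (1 - ε / 8 - ε / 20) * u :=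
    mul_le_mul_of_nonneg_left h (by linarith)
  nlinarith [mul_le_mul_of_nonneg_right h1 hx]

/-- To first order the losses are at most `ε (1/600 + 1/20 + 1/100 + 1/100 + 1/20)`, which is below
`ε / 8`. -/
theorem loss_le {ε δ η : ℝ} (hε : 0 < ε) (hε1 : ε ≤ 1) (hδ : 0 ≤ δ) (hδ1 : δ ≤ ε / 1200)
    (hη : η ≤ ε / 20) :
    1 - ε / 8 ≤ (1 - δ) ^ 2 * (1 - η - 12 * δ) * (1 - ε / 100) * (1 - ε / 20) := by
  have h1 : 1 - ε / 600 ≤ (1 - δ) ^ 2 := by nlinarith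
  have h2 : 1 - ε / 20 - ε / 100 ≤ 1 - η - 12 * δ := by linarith
  have h3 : (1 - ε / 600) * (1 - ε / 20 - ε / 100) ≤ (1 - δ) ^ 2 * (1 - η - 12 * δ) :=
    mul_le_mul h1 h2 (by linarith) (by positivity)
  have h4 : 1 - ε * (1 / 600 + 1 / 20 + 1 / 100) ≤ (1 - ε / 600) * (1 - ε / 20 - ε / 100) := by
    nlinarith
  have h5 : 1 - ε * (1 / 100 + 1 / 20) ≤ (1 - ε / 100) * (1 - ε / 20) := by nlinarith
  have h6 : (1 - ε * (1 / 600 + 1 / 20 + 1 / 100)) * (1 - ε * (1 / 100 + 1 / 20)) ≤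
      (1 - δ) ^ 2 * (1 - η - 12 * δ) * ((1 - ε / 100) * (1 - ε / 20)) :=
    mul_le_mul (h4.trans h3) h5 (by linarith) (le_trans (by linarith) (h4.trans h3))
  rw [mul_assoc ((1 - δ) ^ 2 * (1 - η - 12 * δ))]
  refine le_trans ?_ h6
  nlinarith

/-- In either branch of the minimum the entropy `2k log(2e n p / k)` uses at most half of the
exponent, and the other half is at least `√n`. Both halves rest on `n p = √n √u` with `u` large. -/
theorem large_k_numerics {n k : ℕ} {δ p c θ u : ℝ} (hk : 1 ≤ k) (hδ : 0 < δ) (hp : 0 < p)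
    (hc : 0 < c) (hkp : c < 6 * k * p) (hkn : (k : ℝ) ≤ δ * p * n) (hθ : δ / 2 ≤ θ)
    (hu : u = n * p ^ 2) (hu0 : 0 < u)
    (hy : ∀ y, 1 / δ ≤ y → 2 * Real.exp 1 * y ≤ Real.exp (y / 9600))
    (hu1 : 12 * Real.exp 1 * u / c ≤ Real.exp (u * δ / 9600))
    (hu2 : 4800 ≤ √u) (hu3 : 28800 ≤ √u * (c * δ)) :
    (2 * Real.exp 1 * (n * p / k)) ^ (2 * k) *
        Real.exp (-(min (n * p ^ 2 * (θ * k)) (n * p / 2) / 1200)) ≤ Real.exp (-√(n : ℝ)) := by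
  have hk' : (0 : ℝ) < k := by exact_mod_cast hk
  have hn0 : (0 : ℝ) ≤ n := Nat.cast_nonneg n
  set y := n * p / (k : ℝ) with hyd
  have hyk : y * k = n * p := by rw [hyd]; field_simp
  have hy1 : 1 / δ ≤ y := by
    rw [hyd, div_le_div_iff₀ hδ hk']; linarith
  have hy0 : 0 < y := lt_of_lt_of_le (by positivity) hy1
  have hnp : √(n : ℝ) * √u = n * p := by
    rw [hu, Real.sqrt_mul hn0, Real.sqrt_sq hp.le, ← mul_assoc, Real.mul_self_sqrt hn0]
  have hsn : 0 ≤ √(n : ℝ) := Real.sqrt_nonneg _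
  have key : ∀ a : ℝ, 2 * Real.exp 1 * y ≤ Real.exp a → ∀ b, a * (2 * k) + √(n : ℝ) ≤ b →
      (2 * Real.exp 1 * y) ^ (2 * k) * Real.exp (-b) ≤ Real.exp (-√(n : ℝ)) := by
    intro a ha b hb
    calc (2 * Real.exp 1 * y) ^ (2 * k) * Real.exp (-b)
        ≤ Real.exp a ^ (2 * k) * Real.exp (-b) := by gcongr
      _ = Real.exp (a * (2 * k) - b) := by
        rw [← Real.exp_nat_mul, ← Real.exp_add]; congr 1; push_cast; ring
      _ ≤ _ := Real.exp_le_exp.2 (by linarith)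
  rcases min_choice (n * p ^ 2 * (θ * k)) (n * p / 2) with h | h
  · rw [h]
    refine key (u * δ / 9600) (le_trans ?_ hu1) _ ?_
    · have : y * c ≤ 6 * u := by
        have h1 : y * c ≤ y * (6 * k * p) := mul_le_mul_of_nonneg_left hkp.le hy0.le
        have h2 : y * (6 * k * p) = 6 * u := by
          rw [hu]
          calc y * (6 * k * p) = 6 * (y * k) * p := by ring
            _ = _ := by rw [hyk]; ring
        linarith
      rw [le_div_iff₀ hc]
      have := mul_le_mul_of_nonneg_left this (by positivity : 0 ≤ 2 * Real.exp 1)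
      linarith
    · rw [← hu]
      have h1 : √(n : ℝ) * 4800 ≤ u * δ * k := by
        have h2 : u * k = √(n : ℝ) * √u * (k * p) := by rw [hnp, hu]; ring
        have h3 : √(n : ℝ) * √u * (c / 6) ≤ √(n : ℝ) * √u * (k * p) :=
          mul_le_mul_of_nonneg_left (by linarith) (by positivity)
        calc √(n : ℝ) * 4800 ≤ √(n : ℝ) * (√u * (c * δ) / 6) :=
              mul_le_mul_of_nonneg_left (by linarith) hsn
          _ = √(n : ℝ) * √u * (c / 6) * δ := by ring
          _ ≤ √(n : ℝ) * √u * (k * p) * δ := mul_le_mul_of_nonneg_right h3 hδ.le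
          _ = u * δ * k := by rw [← h2]; ring
      have h4 : u * k * (δ / 2) ≤ u * k * θ := mul_le_mul_of_nonneg_left hθ (by positivity)
      linarith
  · rw [h]
    refine key (y / 9600) (hy y hy1) _ ?_
    have h1 : √(n : ℝ) * 4800 ≤ n * p := by
      rw [← hnp]; exact mul_le_mul_of_nonneg_left hu2 hsn
    have h2 : y / 9600 * (2 * k) = n * p / 4800 := by rw [← hyk]; ring
    rw [h2]
    linarith

theorem dense_numerics {n : ℕ} {D ε δ p β u : ℝ} (hn1 : 1 ≤ n) (hD1 : 1 ≤ D) (hDδ : D * δ ≤ 2)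
    (hβ2 : β ≤ 2) (hβ0 : 0 < β) (hε : 0 < ε) (hε1 : ε ≤ 1) (hδ : 0 < δ) (hδ1 : δ ≤ ε / 1200)
    (hp : 0 ≤ p) (hud : u = n * p ^ 2)
    (hu : (1 + ε) ^ 2 * (2 / (4 - β) * Real.log n) ≤ u) (hu1 : 1 ≤ u)
    (hu2 : 24 * Real.exp 1 ^ 2 / δ * u ^ 2 ≤ Real.exp (ε * δ / 320 * u)) :
    ∃ ζ : ℝ, (1 + δ) * p * (D * Real.exp (-(u * (1 - ε / 8) / 2)) +
        n * Real.exp (-(u * (1 - ε / 8) * ((4 - β) / 4)))) ≤ ζ ∧ D * ((1 + δ) * p) ≤ ζ ∧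
      4 * Real.exp 1 ^ 2 * u * ζ * Real.exp (-(ε / 20 * (1 / D) * u / 8)) ≤
        Real.exp (-(δ * Real.log n)) := by
  have hn0 : (0 : ℝ) < n := by exact_mod_cast hn1
  have hb0 : 0 ≤ (1 + δ) * p := by positivity
  have hL0 : 0 ≤ Real.log n := Real.log_natCast_nonneg n
  have hslack := slack_le hε hε1 (mul_nonneg (div_nonneg zero_le_two (by linarith)) hL0) hu
  have hbn := mul_sqrt_le (n := n) (δ := δ) (p := p) (by linarith) hp
  rw [← hud] at hbn
  clear hud
  have hLu : Real.log n / 2 ≤ 2 / (4 - β) * Real.log n := by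
    have : (1 : ℝ) / 2 ≤ 2 / (4 - β) := by
      rw [div_le_div_iff₀ (by norm_num) (by linarith)]; linarith
    nlinarith
  have hu0 : 0 ≤ u := by linarith
  have hLu' : Real.log n / 2 ≤ u := by
    have : 0 ≤ (2 * ε + ε ^ 2) * (2 / (4 - β) * Real.log n) :=
      mul_nonneg (by positivity) (le_trans (by linarith) hLu)
    nlinarith
  have hexp := exp_half_log hn1
  have hnexp := Real.exp_log hn0
  generalize √(n : ℝ) = R at *
  generalize (n : ℝ) = N at *
  generalize Real.log N = L at *
  generalize hx : u * (1 - ε / 8) = x at *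
  have hx0 : 0 ≤ x := by rw [← hx]; exact mul_nonneg hu0 (by linarith)
  have hεu : 0 ≤ ε * u := by positivity
  -- `ξ = n^(-ε/80)` is the power saved by the surplus. It is needed here because the crude gain
  -- `exp(-εδu/320)` serves only to cancel powers of `u`; the target `n^(-δ)` comes from `ξ`, as `δ
  -- ≤ ε / 1200`.
  generalize hξ : Real.exp (-(ε * L / 80)) = ξ at *
  have hξ0 : 0 < ξ := by rw [← hξ]; exact Real.exp_pos _
  have hR0 : 0 < R := by rw [← hexp]; exact Real.exp_pos _
  have hnξ : N * Real.exp (-(x * ((4 - β) / 4))) ≤ R * ξ := by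
    rw [← hexp, ← hξ]
    rw [← hnexp]
    rw [← Real.exp_add, ← Real.exp_add, Real.exp_le_exp]
    have h1 : (2 / (4 - β) * L + ε / 20 * u) * ((4 - β) / 4) ≤ x * ((4 - β) / 4) :=
      mul_le_mul_of_nonneg_right hslack (by linarith)
    have h2 : 2 / (4 - β) * L * ((4 - β) / 4) = L / 2 := by
      have : (4 - β) ≠ 0 := by linarith
      field_simp
      norm_num
    have h3 : ε / 20 * (L / 2) * (1 / 2) ≤ ε / 20 * u * ((4 - β) / 4) :=
      mul_le_mul (mul_le_mul_of_nonneg_left hLu' (by positivity)) (by linarith) (by norm_num)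
        (by positivity)
    linarith
  have hDξ : D * ((1 + δ) * p) ≤ 4 / δ * √u * ξ := by
    have h1 : (1 : ℝ) ≤ R * ξ := by
      rw [← hexp, ← hξ, ← Real.exp_add, Real.one_le_exp_iff]
      have : ε * L ≤ 1 * L := mul_le_mul_of_nonneg_right hε1 hL0
      linarith
    have h2 : D ≤ 2 / δ := (le_div_iff₀ hδ).2 hDδ
    calc D * ((1 + δ) * p) ≤ 2 / δ * ((1 + δ) * p) := mul_le_mul_of_nonneg_right h2 hb0
      _ = 2 / δ * ((1 + δ) * p) * 1 := by ring
      _ ≤ 2 / δ * ((1 + δ) * p) * (R * ξ) := mul_le_mul_of_nonneg_left h1 (by positivity)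
      _ = 2 / δ * ((1 + δ) * p * R) * ξ := by ring
      _ ≤ 2 / δ * (2 * √u) * ξ := by gcongr
      _ = _ := by ring
  have hδle : (1 : ℝ) ≤ 1 / δ := by rw [le_div_iff₀ hδ]; linarith
  have hZ : (1 + δ) * p * (D * Real.exp (-(x / 2)) + N * Real.exp (-(x * ((4 - β) / 4)))) ≤
      6 / δ * √u * ξ := by
    have h3 : D * Real.exp (-(x / 2)) ≤ D := by
      have : Real.exp (-(x / 2)) ≤ 1 := Real.exp_le_one_iff.2 (by linarith)
      nlinarith
    have h4 : (1 + δ) * p * (R * ξ) ≤ 2 / δ * √u * ξ := by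
      calc (1 + δ) * p * (R * ξ) = (1 + δ) * p * R * ξ := by ring
        _ ≤ 2 * √u * ξ := by gcongr
        _ = 2 * √u * ξ * 1 := by ring
        _ ≤ 2 * √u * ξ * (1 / δ) := mul_le_mul_of_nonneg_left hδle (by positivity)
        _ = _ := by ring
    calc _ ≤ (1 + δ) * p * (D + R * ξ) := by gcongr
      _ = D * ((1 + δ) * p) + (1 + δ) * p * (R * ξ) := by ring
      _ ≤ 4 / δ * √u * ξ + 2 / δ * √u * ξ := add_le_add hDξ h4
      _ = _ := by ring
  have hD0 : (0 : ℝ) < D := by linarith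
  have hθ : δ / 2 ≤ 1 / D := by rw [div_le_div_iff₀ (by norm_num) hD0]; linarith
  have hfin : 4 * Real.exp 1 ^ 2 * u * (6 / δ * √u * ξ) *
      Real.exp (-(ε / 20 * (1 / D) * u / 8)) ≤ Real.exp (-(δ * L)) := by
    have h1 : √u ≤ u := (Real.sqrt_le_left hu0).2 (by nlinarith)
    have h2 : 4 * Real.exp 1 ^ 2 * u * (6 / δ * √u) ≤ 24 * Real.exp 1 ^ 2 / δ * u ^ 2 := by
      calc 4 * Real.exp 1 ^ 2 * u * (6 / δ * √u) = 24 * Real.exp 1 ^ 2 / δ * u * √u := by ring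
        _ ≤ 24 * Real.exp 1 ^ 2 / δ * u * u := by gcongr
        _ = _ := by ring
    have h3 : Real.exp (-(ε / 20 * (1 / D) * u / 8)) ≤ Real.exp (-(ε * δ / 320 * u)) := by
      rw [Real.exp_le_exp]
      have := mul_le_mul_of_nonneg_left hθ hεu
      linarith
    calc _ = 4 * Real.exp 1 ^ 2 * u * (6 / δ * √u) *
          Real.exp (-(ε / 20 * (1 / D) * u / 8)) * ξ := by ring
      _ ≤ Real.exp (ε * δ / 320 * u) * Real.exp (-(ε * δ / 320 * u)) * ξ := by
        refine mul_le_mul_of_nonneg_right ?_ hξ0.le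
        exact mul_le_mul (h2.trans hu2) h3 (Real.exp_pos _).le (Real.exp_pos _).le
      _ = ξ := by rw [← Real.exp_add]; simp
      _ ≤ _ := by
        rw [← hξ, Real.exp_le_exp]
        have := mul_le_mul_of_nonneg_right hδ1 hL0
        have : 0 ≤ ε * L := by positivity
        linarith
  refine ⟨6 / δ * √u * ξ, hZ, hDξ.trans ?_, hfin⟩
  gcongr
  norm_num

end Numerics

/-! ### Small `k`: the sparse and dense cases -/

section Cases

variable {G : Type*} [AddCommGroup G] [Fintype G] [DecidableEq G] {O : Finset G}

theorem card_compl_erase_le {n : ℕ} (hn : O.card = n) (hG : Fintype.card G = 2 * n) :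
    (Oᶜ.erase 0).card ≤ n := by
  refine Finset.card_erase_le.trans ?_
  rw [Finset.card_compl, hn, hG]; omega

/-- Since `l ≥ 1/3` and `log r ≤ (l + 1/2) log n`, both the elements with `2s = 0` and the others
contribute at most `√n` to the weighted sum, so `ζ = 4 √u`. The crude gain, with `θ = 1`, then
absorbs the powers of `u` and yields `n^(-δ)`. -/
theorem eventB_le_sparse (hO : OddCoset O) {n k : ℕ} (hn1 : 1 ≤ n) (hn : O.card = n)
    (hG : Fintype.card G = 2 * n) {ε δ p l : ℝ} (hε : 0 < ε) (hε1 : ε ≤ 1) (hδ : 0 < δ)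
    (hδ1 : δ ≤ ε / 1200) (hp : 0 < p) (hp1 : (1 + δ) * p ≤ 1) (hkp : 6 * k * p ≤ ε / 100)
    (hkn : (k : ℝ) ≤ δ * n) (hl : 1 / 3 ≤ l) (hrl : Real.log (r G) ≤ (l + 1 / 2) * Real.log n)
    (hr : (r G : ℝ) ≤ δ * n) (hu : (1 + ε) ^ 2 * (l * Real.log n) ≤ n * p ^ 2)
    (hu1 : 1 ≤ n * p ^ 2)
    (hu2 : 16 * Real.exp 1 ^ 2 * (n * p ^ 2) ^ 2 ≤ Real.exp (ε / 320 * (n * p ^ 2))) :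
    randomSubsetProb (biasedProb O δ p) (EventB O k) ≤ Real.exp (-(δ * Real.log n)) ^ k := by
  classical
  set u : ℝ := n * p ^ 2 with hud
  set L := Real.log n with hL
  have hL0 : 0 ≤ L := Real.log_natCast_nonneg n
  have hn0 : (0 : ℝ) < n := by exact_mod_cast hn1
  have hb0 : 0 ≤ (1 + δ) * p := by positivity
  have hslack := slack_le hε hε1 (by positivity) hu
  have hbn := mul_sqrt_le (n := n) (δ := δ) (p := p) (by linarith) hp.le
  rw [← hud] at hbn
  have hsqu : 1 ≤ √u := Real.one_le_sqrt.2 hu1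
  have hlu : l * L ≤ u * (1 - ε / 8) := by
    have : 0 ≤ ε / 20 * u := by positivity
    linarith
  have hZ : (1 + δ) * p * ∑ s ∈ Oᶜ.erase 0, Real.exp (-(u * (1 - ε / 8) * sparseWeight s)) ≤
      4 * √u := by
    have h1 := sum_exp_sparseWeight_le (card_compl_erase_le hn hG) (u * (1 - ε / 8))
    have h2 : (r G : ℝ) * Real.exp (-(u * (1 - ε / 8))) ≤ √(n : ℝ) := by
      rw [← exp_half_log hn1, ← Real.exp_log (show (0 : ℝ) < r G by exact_mod_cast r_pos),
        ← Real.exp_add, Real.exp_le_exp]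
      linarith
    have h3 : (n : ℝ) * Real.exp (-(3 / 2 * (u * (1 - ε / 8)))) ≤ √(n : ℝ) := by
      rw [← exp_half_log hn1]
      nth_rewrite 1 [← Real.exp_log hn0]
      rw [← Real.exp_add, Real.exp_le_exp]
      nlinarith
    have h4 := mul_le_mul_of_nonneg_left (h1.trans (add_le_add h2 h3)) hb0
    linarith
  have hD : ∀ D : ℕ, (D : ℝ) ≤ 2 * √(n : ℝ) → D * ((1 + δ) * p) ≤ 4 * √u := fun D hD => by
    have := mul_le_mul_of_nonneg_right hD hb0
    linarith
  have hcrude : ∀ S ∈ (Oᶜ.erase 0).powersetCard k, ∃ S' ⊆ S, 1 * (k : ℝ) ≤ S'.card ∧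
      n * (S'.card : ℝ) / 3 ≤ (schurGraph O S').card := fun S hS => by
    obtain ⟨h1, h2⟩ := Finset.mem_powersetCard.1 hS
    refine ⟨S, subset_rfl, by rw [h2, one_mul], third_mul_card_le_schurGraph hO hn
      (hr.trans (mul_le_mul_of_nonneg_right (by linarith) hn0.le)) h1⟩
  have hfin : 4 * Real.exp 1 ^ 2 * u * (4 * √u) * Real.exp (-(ε / 20 * 1 * u / 8)) ≤
      Real.exp (-(δ * L)) := by
    have h1 : √u ≤ u := (Real.sqrt_le_left (by linarith)).2 (by nlinarith)
    have h2 : 4 * Real.exp 1 ^ 2 * u * (4 * √u) ≤ 16 * Real.exp 1 ^ 2 * u ^ 2 := by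
      have : 16 * Real.exp 1 ^ 2 * u * √u ≤ 16 * Real.exp 1 ^ 2 * u * u := by gcongr
      linarith
    calc _ ≤ Real.exp (ε / 320 * u) * Real.exp (-(ε / 20 * 1 * u / 8)) :=
          mul_le_mul_of_nonneg_right (h2.trans hu2) (Real.exp_pos _).le
      _ = Real.exp (-(ε * u / 320)) := by rw [← Real.exp_add]; congr 1; ring
      _ ≤ _ := by
        rw [Real.exp_le_exp]
        have h3 : L ≤ 3 * u := by
          have : 0 ≤ ε / 8 * u := by positivity
          nlinarith
        have h4 : δ * L ≤ ε / 1200 * (3 * u) := mul_le_mul hδ1 h3 hL0 (by positivity)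
        have : 0 ≤ ε * u := by positivity
        linarith
  have hweight : ∀ s : G, 1 / 2 ≤ sparseWeight s := fun s => by
    linarith [one_le_sparseWeight s]
  -- For `r ≤ √n` overlaps are negligible and classes up to sign have size at most 2. For `r > √n`
  -- the cosets of `2G` have size `2n / r < 2 √n`, small enough for `D * ((1 + δ) * p) ≤ 4 √u`.
  by_cases hrn : (r G : ℝ) ≤ √(n : ℝ)
  · have hrk : 2 * (r G : ℝ) * k ≤ ε / 300 * n := by
      have h1 : √(n : ℝ) ≤ n * p := by
        have : √(n : ℝ) * √u = n * p := by
          rw [hud, Real.sqrt_mul hn0.le, Real.sqrt_sq hp.le, ← mul_assoc,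
            Real.mul_self_sqrt hn0.le]
        nlinarith [Real.sqrt_nonneg (n : ℝ)]
      have h2 : (r G : ℝ) * k ≤ n * p * k :=
        mul_le_mul_of_nonneg_right (hrn.trans h1) (Nat.cast_nonneg k)
      have h3 : (n : ℝ) * (6 * k * p) ≤ n * (ε / 100) := mul_le_mul_of_nonneg_left hkp hn0.le
      linarith
    refine (eventB_le_of_small hO hn hδ.le (by linarith) hp.le hp1 hkn hkp (by linarith)
      (η := δ + ε / 300) (τ := ε / 20) (g := ε / 8) (θ := 1) (ζ := 4 * √u)
      (by linarith) (by linarith) (by linarith) ?_ (by linarith)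
      (fun s : G => s(s, -s)) (D := 2) card_sym_class (w := sparseWeight) hweight ?_ hcrude hZ
      (hD 2 ?_)).trans (pow_le_pow_left₀ (by positivity) hfin k)
    · exact loss_le hε hε1 hδ.le hδ1 (by linarith)
    · exact fun S' hS' hinj hk => sparse_sharp_sym hO hn hr hrk hS' hk hinj
    · have : (1 : ℝ) ≤ √(n : ℝ) := Real.one_le_sqrt.2 (by exact_mod_cast hn1)
      push_cast; linarith
  · refine (eventB_le_of_small hO hn hδ.le (by linarith) hp.le hp1 hkn hkp (by linarith)
      (η := δ) (τ := ε / 20) (g := ε / 8) (θ := 1) (ζ := 4 * √u)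
      (by linarith) (by linarith) (by linarith) ?_ (by linarith)
      (fun s : G => (s : G ⧸ doubles G)) (D := Nat.card (doubles G)) card_coset_doubles
      (w := sparseWeight) hweight ?_ hcrude hZ
      (hD _ ?_)).trans (pow_le_pow_left₀ (by positivity) hfin k)
    · exact loss_le hε hε1 hδ.le hδ1 (by linarith)
    · exact fun S' hS' hinj _ => sparse_sharp_mk hO hn hr hS' hinj
    · have h1 : (Nat.card (doubles G) : ℝ) * r G = 2 * n := by
        have h2 := card_doubles_mul_r (G := G)
        rw [hG] at h2
        exact_mod_cast h2
      have h2 : (Nat.card (doubles G) : ℝ) * √(n : ℝ) ≤ 2 * √(n : ℝ) * √(n : ℝ) := by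
        rw [mul_assoc, Real.mul_self_sqrt hn0.le, ← h1]
        exact mul_le_mul_of_nonneg_left (le_of_not_ge hrn) (Nat.cast_nonneg _)
      exact le_of_mul_le_mul_right h2 (Real.sqrt_pos.2 hn0)

theorem eventB_le_dense (hO : OddCoset O) {n k : ℕ} (hn1 : 1 ≤ n) (hn : O.card = n)
    (hG : Fintype.card G = 2 * n) {ε δ p β : ℝ} (hε : 0 < ε) (hε1 : ε ≤ 1) (hδ : 0 < δ)
    (hδ1 : δ ≤ ε / 1200) (hp : 0 < p) (hp1 : (1 + δ) * p ≤ 1) (hkp : 6 * k * p ≤ ε / 100)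
    (hkn : (k : ℝ) ≤ δ * n) (hβ : (r G : ℝ) = β * n) (hβδ : δ ≤ β)
    (hu : (1 + ε) ^ 2 * (2 / (4 - β) * Real.log n) ≤ n * p ^ 2)
    (hu1 : 1 ≤ n * p ^ 2)
    (hu2 : 24 * Real.exp 1 ^ 2 / δ * (n * p ^ 2) ^ 2 ≤ Real.exp (ε * δ / 320 * (n * p ^ 2))) :
    randomSubsetProb (biasedProb O δ p) (EventB O k) ≤ Real.exp (-(δ * Real.log n)) ^ k := by
  classical
  have hn0 : (0 : ℝ) < n := by exact_mod_cast hn1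
  have hb0 : 0 ≤ (1 + δ) * p := by positivity
  have hDr : (Nat.card (doubles G) : ℝ) * β = 2 := by
    have h1 : (Nat.card (doubles G) : ℝ) * r G = 2 * n := by
      have h2 := card_doubles_mul_r (G := G)
      rw [hG] at h2
      exact_mod_cast h2
    rw [hβ, ← mul_assoc] at h1
    exact mul_right_cancel₀ hn0.ne' h1
  have hD1 : (1 : ℝ) ≤ Nat.card (doubles G) := by exact_mod_cast card_doubles_pos (G := G)
  have hβ2 : β ≤ 2 := by nlinarith
  have hDδ : Nat.card (doubles G) * δ ≤ 2 := by nlinarith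
  obtain ⟨ζ, hZ, hDζ, hfin⟩ := dense_numerics hn1 hD1 hDδ hβ2 (hδ.trans_le hβδ) hε hε1 hδ hδ1 hp.le
    rfl hu hu1 hu2
  have hζ0 : 0 ≤ ζ := le_trans (by positivity) hDζ
  refine (eventB_le_of_small hO hn hδ.le (by linarith) hp.le hp1 hkn hkp (by linarith)
    (η := 0) (τ := ε / 20) (g := ε / 8) (θ := 1 / (Nat.card (doubles G) : ℝ)) (ζ := ζ)
    (by linarith) (by linarith) (by linarith) ?_ (by linarith)
    (fun s : G => (s : G ⧸ doubles G)) (D := Nat.card (doubles G)) card_coset_doubles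
    (w := denseWeight β) (half_le_denseWeight hβ2) ?_ ?_ ?_ hDζ).trans
    (pow_le_pow_left₀ (by positivity) hfin k)
  · exact loss_le hε hε1 hδ.le hδ1 (by linarith)
  · intro S' hS' hinj _
    rw [sub_zero, mul_one]
    exact dense_sharp hO hn hβ hβ2 hS' hinj
  · intro S hS
    obtain ⟨h1, h2⟩ := Finset.mem_powersetCard.1 hS
    obtain ⟨S', hS', h3, h4⟩ := dense_crude hn h1
    exact ⟨S', hS', by rw [← h2]; exact h3, h4 S' subset_rfl⟩
  · exact (mul_le_mul_of_nonneg_left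
      (sum_exp_denseWeight_le (card_compl_erase_le hn hG) β _) hb0).trans hZ

end Cases

/-! ### Interpreting `λ`, and assembly of the proof -/

section Main

variable {G : Type*} [AddCommGroup G] [Fintype G] [DecidableEq G]

theorem card_div_two {n : ℕ} (hG : Fintype.card G = 2 * n) : (Nat.card G : ℝ) / 2 = n := by
  rw [Nat.card_eq_fintype_card, hG]
  push_cast
  ring

theorem r_eq_beta_mul {n : ℕ} (hn1 : 1 ≤ n) (hG : Fintype.card G = 2 * n) :
    (r G : ℝ) = beta G * n := by
  have hn0 : (0 : ℝ) < n := by exact_mod_cast hn1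
  rw [beta, card_div_two hG, div_mul_cancel₀ _ hn0.ne']

theorem beta_pos {n : ℕ} (hn1 : 1 ≤ n) (hG : Fintype.card G = 2 * n) : 0 < beta G := by
  have hn0 : (0 : ℝ) < n := by exact_mod_cast hn1
  rw [beta, card_div_two hG]
  exact div_pos (by exact_mod_cast r_pos) hn0

theorem beta_le_two {n : ℕ} (hn1 : 1 ≤ n) (hG : Fintype.card G = 2 * n) : beta G ≤ 2 := by
  have hn0 : (0 : ℝ) < n := by exact_mod_cast hn1
  have h : r G ≤ 2 * n := by
    rw [r_eq_card, ← hG, ← Finset.card_univ]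
    exact Finset.card_filter_le _ _
  rw [beta, card_div_two hG, div_le_iff₀ hn0]
  exact_mod_cast h

theorem log_r_eq {n : ℕ} (hG : Fintype.card G = 2 * n) (hL : 0 < Real.log n) :
    Real.log (r G) = alpha G * Real.log n := by
  rw [alpha, card_div_two hG, div_mul_cancel₀ _ hL.ne']

theorem lam_of_beta_lt {δ : ℝ} (hβ : beta G < δ) :
    1 / 3 ≤ lam δ G ∧ alpha G - 1 / 2 ≤ lam δ G := by
  unfold lam
  split_ifs with h
  · constructor <;> linarith
  · constructor <;> linarith

/-- If `r ≥ δ n`, then `α ≥ 1 + log δ / log n`, which exceeds `5/6` once `log n > -6 log δ`. The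
first branch of `λ` is thus excluded. -/
theorem lam_of_le_beta {n : ℕ} (hn1 : 1 ≤ n) (hG : Fintype.card G = 2 * n) {δ : ℝ} (hδ : 0 < δ)
    (hβ : δ ≤ beta G) (hL : 0 < Real.log n) (hLδ : -6 * Real.log δ < Real.log n) :
    lam δ G = 2 / (4 - beta G) := by
  have hn0 : (0 : ℝ) < n := by exact_mod_cast hn1
  have h1 : ¬ alpha G ≤ 5 / 6 := by
    intro h
    have h2 := log_r_eq hG hL
    rw [r_eq_beta_mul hn1 hG, Real.log_mul (beta_pos hn1 hG).ne' hn0.ne'] at h2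
    have h3 := Real.log_le_log hδ hβ
    nlinarith
  rw [lam, if_neg h1, if_neg hβ.not_gt]

theorem lam_bound {n : ℕ} (hn1 : 1 ≤ n) {ε ε' l p : ℝ} (hε' : 0 < ε') (hεε : ε' ≤ ε)
    (hl : 0 ≤ l) (hp : (1 + ε) * √(l * (Real.log n / n)) ≤ p) :
    (1 + ε') ^ 2 * (l * Real.log n) ≤ n * p ^ 2 := by
  have hn0 : (0 : ℝ) < n := by exact_mod_cast hn1
  have hL0 : 0 ≤ Real.log n := Real.log_natCast_nonneg n
  have h1 : (1 + ε') * √(l * (Real.log n / n)) ≤ p := by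
    refine le_trans ?_ hp
    gcongr
  have h2 : ((1 + ε') * √(l * (Real.log n / n))) ^ 2 ≤ p ^ 2 :=
    pow_le_pow_left₀ (by positivity) h1 2
  rw [mul_pow, Real.sq_sqrt (by positivity)] at h2
  calc (1 + ε') ^ 2 * (l * Real.log n) = n * ((1 + ε') ^ 2 * (l * (Real.log n / n))) := by
        field_simp
    _ ≤ _ := mul_le_mul_of_nonneg_left h2 hn0.le

end Main

end SumFreeThreshold

theorem mainTheorem3 :
    ∀ ε : ℝ, 0 < ε → ∃ δ₀ : ℝ, 0 < δ₀ ∧ ∀ δ : ℝ, 0 < δ → δ < δ₀ →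
      ∃ n₀ : ℕ, ∀ n : ℕ, n₀ ≤ n →
        ∀ (G : Type*) [AddCommGroup G] [Fintype G] [DecidableEq G], Fintype.card G = 2 * n →
          ∀ O ∈ SumFreeThreshold.SF (Finset.univ : Finset G),
            ∀ p : ℝ,
              (1 + ε) * Real.sqrt (SumFreeThreshold.lam δ G * (Real.log n / n)) ≤ p →
              (1 + δ) * p ≤ 1 →
              ∀ k : ℕ, 1 ≤ k → (k : ℝ) ≤ δ * p * n →
                SumFreeThreshold.randomSubsetProb (SumFreeThreshold.biasedProb O δ p)
                    (SumFreeThreshold.EventB O k)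
                  ≤ max ((n : ℝ) ^ (-(δ * k))) (Real.exp (-Real.sqrt n)) := by
  open SumFreeThreshold in
  intro ε' hε'
  obtain ⟨ε, hε, hε1, hεε⟩ : ∃ ε : ℝ, 0 < ε ∧ ε ≤ 1 ∧ ε ≤ ε' :=
    ⟨min ε' 1, lt_min hε' one_pos, min_le_right _ _, min_le_left _ _⟩
  obtain ⟨Y, hY1, hY⟩ := exists_forall_sq_le_exp (2 * Real.exp 1) (b := 1 / 9600) (by norm_num)
  -- `ε / 1200` is the budget of `loss_le`; `1 / Y` makes `n p / k ≥ 1 / δ` large enough for the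
  -- exponential to beat the entropy when `k` is large.
  refine ⟨min (ε / 1200) (1 / Y), lt_min (by positivity) (by positivity), fun δ hδ hδ₀ => ?_⟩
  have hδ1 : δ ≤ ε / 1200 := (hδ₀.trans_le (min_le_left _ _)).le
  have hδY : Y ≤ 1 / δ := by
    rw [le_div_iff₀ hδ, mul_comm]
    exact (le_div_iff₀ (by linarith)).1 (hδ₀.trans_le (min_le_right _ _)).le
  obtain ⟨U₁, -, hU₁⟩ := exists_forall_sq_le_exp (16 * Real.exp 1 ^ 2) (b := ε / 320)
    (by positivity)
  obtain ⟨U₂, -, hU₂⟩ := exists_forall_sq_le_exp (24 * Real.exp 1 ^ 2 / δ) (b := ε * δ / 320)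
    (by positivity)
  obtain ⟨U₃, -, hU₃⟩ := exists_forall_sq_le_exp (12 * Real.exp 1 / (ε / 100)) (b := δ / 9600)
    (by positivity)
  have hlog : Filter.Tendsto (fun n : ℕ => Real.log n) Filter.atTop Filter.atTop :=
    Real.tendsto_log_atTop.comp tendsto_natCast_atTop_atTop
  -- Each lower bound on `n p²` is obtained from `n p² ≥ log n / 3`, hence the factors 3.
  obtain ⟨n₀, hn₀⟩ := Filter.eventually_atTop.1
    ((hlog.eventually_ge_atTop (3 * U₁)).and ((hlog.eventually_ge_atTop (3 * U₂)).and
    ((hlog.eventually_ge_atTop (3 * U₃)).and ((hlog.eventually_ge_atTop (3 * 4800 ^ 2)).and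
    ((hlog.eventually_ge_atTop (3 * (28800 / (ε / 100 * δ)) ^ 2)).and
    ((hlog.eventually_gt_atTop (-6 * Real.log δ)).and (Filter.eventually_ge_atTop 1)))))))
  refine ⟨n₀, fun n hn G _ _ _ hG O hO p hp hp1 k hk hkn => ?_⟩
  obtain ⟨h1, h2, h3, h4, h5, h6, hn1⟩ := hn₀ n hn
  obtain ⟨hodd, hOn⟩ := oddCoset_of_mem_SF hn1 hG hO
  have hn0 : (0 : ℝ) < n := by exact_mod_cast hn1
  have hL : 0 < Real.log n := by linarith
  have hk' : (1 : ℝ) ≤ k := by exact_mod_cast hk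
  have hp0 : 0 < p := by
    by_contra! h
    have : δ * p * n ≤ 0 :=
      mul_nonpos_of_nonpos_of_nonneg (mul_nonpos_of_nonneg_of_nonpos hδ.le h) hn0.le
    linarith
  have hp1' : p ≤ 1 := by nlinarith
  have hkn' : (k : ℝ) ≤ δ * n := by
    have : δ * n * p ≤ δ * n * 1 := mul_le_mul_of_nonneg_left hp1' (by positivity)
    linarith
  have hβ2 := beta_le_two hn1 hG
  have hβ0 := beta_pos hn1 hG
  have hlam : 1 / 3 ≤ lam δ G := by
    by_cases hβ : beta G < δ
    · exact (lam_of_beta_lt hβ).1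
    · rw [lam_of_le_beta hn1 hG hδ (not_lt.1 hβ) hL h6, div_le_div_iff₀ (by norm_num) (by linarith)]
      linarith
  have hu := lam_bound hn1 hε hεε (by linarith) hp
  have hLu : Real.log n / 3 ≤ n * p ^ 2 := by
    have h7 : 1 / 3 * Real.log n ≤ lam δ G * Real.log n := mul_le_mul_of_nonneg_right hlam hL.le
    have h8 : 0 ≤ (2 * ε + ε ^ 2) * (lam δ G * Real.log n) :=
      mul_nonneg (by positivity) (le_trans (by positivity) h7)
    linarith
  have hu1 : 1 ≤ n * p ^ 2 := by linarith
  -- Below this cutoff the Janson correction costs at most a factor `1 - ε / 100`, so the sharp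
  -- constant survives.
  by_cases hkp : 6 * k * p ≤ ε / 100
  · refine le_trans ?_ (le_max_left _ _)
    have hpow : (n : ℝ) ^ (-(δ * k)) = Real.exp (-(δ * Real.log n)) ^ k := by
      rw [Real.rpow_def_of_pos hn0, ← Real.exp_nat_mul]
      congr 1
      ring
    rw [hpow]
    by_cases hβ : beta G < δ
    · obtain ⟨hl1, hl2⟩ := lam_of_beta_lt hβ
      refine eventB_le_sparse hodd hn1 hOn hG hε hε1 hδ hδ1 hp0 hp1 hkp hkn' hl1 ?_ ?_ hu hu1
        (hU₁ _ (by linarith))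
      · rw [log_r_eq hG hL]
        exact mul_le_mul_of_nonneg_right (by linarith) hL.le
      · rw [r_eq_beta_mul hn1 hG]
        exact mul_le_mul_of_nonneg_right hβ.le hn0.le
    · rw [lam_of_le_beta hn1 hG hδ (not_lt.1 hβ) hL h6] at hu
      exact eventB_le_dense hodd hn1 hOn hG hε hε1 hδ hδ1 hp0 hp1 hkp hkn'
        (r_eq_beta_mul hn1 hG) (not_lt.1 hβ) hu hu1 (hU₂ _ (by linarith))
  · refine le_trans ?_ (le_max_right _ _)
    obtain ⟨θ, hθ, hcrude⟩ : ∃ θ : ℝ, δ / 2 ≤ θ ∧ ∀ S ∈ (Oᶜ.erase 0).powersetCard k,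
        ∃ S' ⊆ S, θ * k ≤ S'.card ∧
          ∀ S'' ⊆ S', n * (S''.card : ℝ) / 3 ≤ (schurGraph O S'').card := by
      by_cases hβ : beta G < δ
      · refine ⟨1, by linarith, fun S hS => ?_⟩
        obtain ⟨hS1, hS2⟩ := Finset.mem_powersetCard.1 hS
        refine ⟨S, subset_rfl, by rw [hS2, one_mul], fun S'' hS'' =>
          third_mul_card_le_schurGraph hodd hOn ?_ (hS''.trans hS1)⟩
        rw [r_eq_beta_mul hn1 hG]
        exact mul_le_mul_of_nonneg_right (by linarith) hn0.le
      · refine ⟨1 / Nat.card (doubles G), ?_, fun S hS => ?_⟩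
        · have h7 : (Nat.card (doubles G) : ℝ) * beta G * n = 2 * n := by
            rw [mul_assoc, ← r_eq_beta_mul hn1 hG]
            have h8 := card_doubles_mul_r (G := G)
            rw [hG] at h8
            exact_mod_cast h8
          have h9 : (Nat.card (doubles G) : ℝ) * beta G = 2 := mul_right_cancel₀ hn0.ne' h7
          have h10 : (0 : ℝ) < Nat.card (doubles G) := by exact_mod_cast card_doubles_pos
          rw [div_le_div_iff₀ (by norm_num) h10]
          nlinarith [not_lt.1 hβ]
        · obtain ⟨hS1, hS2⟩ := Finset.mem_powersetCard.1 hS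
          obtain ⟨S', hS', h7, h8⟩ := dense_crude hOn hS1
          exact ⟨S', hS', by rw [← hS2]; exact h7, h8⟩
    refine (eventB_le_of_large hodd hOn hG hδ.le (by linarith) hp0 hp1 hk hkn hcrude).trans ?_
    refine large_k_numerics hk hδ hp0 (c := ε / 100) (by positivity) (not_le.1 hkp) hkn hθ rfl
      (by linarith) (fun y hy => ?_) ?_ ?_ ?_
    · have h7 : 1 ≤ y := hY1.trans (hδY.trans hy)
      have h8 := hY y (hδY.trans hy)
      have h9 : y ≤ y ^ 2 := by nlinarith
      rw [one_div, inv_mul_eq_div] at h8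
      exact (mul_le_mul_of_nonneg_left h9 (by positivity)).trans h8
    · have h7 := hU₃ (n * p ^ 2) (by linarith)
      have h9 : n * p ^ 2 ≤ (n * p ^ 2) ^ 2 := by nlinarith
      calc 12 * Real.exp 1 * (n * p ^ 2) / (ε / 100)
          = 12 * Real.exp 1 / (ε / 100) * (n * p ^ 2) := by ring
        _ ≤ 12 * Real.exp 1 / (ε / 100) * (n * p ^ 2) ^ 2 :=
          mul_le_mul_of_nonneg_left h9 (by positivity)
        _ ≤ Real.exp (δ / 9600 * (n * p ^ 2)) := h7
        _ = _ := by congr 1; ring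
    · exact Real.le_sqrt_of_sq_le (by linarith)
    · rw [← div_le_iff₀ (by positivity)]
      exact Real.le_sqrt_of_sq_le (by linarith)
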